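/- Let $F$ be a probability distribution on the non-negative integers, and let $\mathcal P$ be a rate $1$ Poisson process on $\mathbb R$ whose points $x$ carry iid degrees $D_x$ with distribution $F$, independent of the points; think of $D_x$ as the number of stubs at $x$, numbered $1,\dots,D_x$. Write $[\mathcal P]$ for the set of points, $[\mathcal P]_i=\{x\in[\mathcal P]: D_x\ge i\}$, $p_i=F(\{i\})$ and $p_{i+}=\sum_{j\ge i}p_j$. In shifted adjacent matching (SAM) the stubs are paired level by level, as follows. For each level $i\ge 1$ pick, by a fair coin (the coins being independent of each other and of the marked process), one of the two perfect matchings of $[\mathcal P]_i$ in which no point of $[\mathcal P]_i$ lies strictly between two matched points. Call a point right-oriented (left-oriented) if it is matched to a point on its right (left), and pair the $i$-th stub of each right-oriented point $x$ with the $i$-th stub of the $i$-th left-oriented point to the right of $x$. Let $\mathbb P^*,\mathbb E^*$ refer to the Palm version, with respect to $\mathcal P$, of the marked process together with this pairing, i.e. $\mathbb E^*[f]=\mathbb E\big[\sum_{x\in[\mathcal P]\cap[0,1)}f(\text{configuration translated by }-x)\big]/\mathbb E\big[\#([\mathcal P]\cap[0,1))\big]$. Let $D$ be the degree of the origin, let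 $L_i$ be the length of the edge at the $i$-th stub of the origin ($L_i=0$ if $D<i$), and let $T=\sum_{i\ge1}L_i$ be the total length of the edges at the origin. Then: 1. If $F$ has bounded support and $u=\max\{i:p_i>0\}$, then $\mathbb E^*[T]=u^2$. 2. For every $i\ge 1$ with $p_{i+}>0$, $\mathbb E^*[L_i\mid D\ge i]=(2i-1)/p_{i+}$. 3. $\mathbb E^*[T]<\infty$ if and only if $F$ has bounded support. -/

import Mathlib

open MeasureTheory ProbabilityTheory Set
open scoped ENNReal

noncomputable section

namespace SAM

/-! ## The marked Poisson process on the line -/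

/-- The points `X 0 ω, X 1 ω, …` (distinct, in any order) form a homogeneous Poisson process
on `ℝ` with rate `1`: the number of points in a Borel set of finite volume is Poisson with
mean the volume, and the numbers of points in disjoint Borel sets are independent. -/
structure IsPoissonProcess {Ω : Type*} [MeasurableSpace Ω] (P : Measure Ω)
    (X : ℕ → Ω → ℝ) : Prop where
  measurable : ∀ n, Measurable (X n)
  injective : ∀ᵐ ω ∂P, Function.Injective fun n => X n ω
  count_law : ∀ B : Set ℝ, MeasurableSet B → volume B < ∞ → ∀ k : ℕ,
    P {ω | (range (fun n => X n ω) ∩ B).encard = k} = poissonMeasure (volume B).toNNReal {k}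
  count_indep : ∀ (m : ℕ) (B : Fin m → Set ℝ), (∀ j, MeasurableSet (B j)) →
    Pairwise (fun j k => Disjoint (B j) (B k)) →
    iIndepFun (fun j ω => (range (fun n => X n ω) ∩ B j).encard) P

/-- A rate `1` Poisson process whose points carry iid marks (degrees) with distribution `F`,
independent of the points; `D n` is the mark of `X n`. -/
structure IsMarkedPoisson {Ω : Type*} [MeasurableSpace Ω] (P : Measure Ω) (F : PMF ℕ)
    (X : ℕ → Ω → ℝ) (D : ℕ → Ω → ℕ) : Prop where
  ground : IsPoissonProcess P X
  measurable_mark : ∀ n, Measurable (D n)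
  mark_law : ∀ n, P.map (D n) = F.toMeasure
  mark_indep : iIndepFun D P
  mark_indep_ground : IndepFun (fun ω n => X n ω) (fun ω n => D n ω) P

/-- The set of marked points `(x, d)`: `x` is a vertex and `d` its number of stubs. -/
def markedSet {Ω : Type*} (X : ℕ → Ω → ℝ) (D : ℕ → Ω → ℕ) (ω : Ω) : Set (ℝ × ℕ) :=
  range fun n => (X n ω, D n ω)

/-- The vertices with at least `i` stubs. -/
def level (A : Set (ℝ × ℕ)) (i : ℕ) : Set ℝ := {x | ∃ d, (x, d) ∈ A ∧ i ≤ d}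

/-! ## Shifted adjacent matching -/

/-- `M` matches every point of `S` to exactly one other point of `S`, and no point of `S` lies
strictly between two matched points. -/
structure IsAdjacentMatching (S : Set ℝ) (M : SimpleGraph ℝ) : Prop where
  mem : ∀ x y, M.Adj x y → x ∈ S
  existsUnique : ∀ x ∈ S, ∃! y, M.Adj x y
  adjacent : ∀ x y, M.Adj x y → ∀ z ∈ S, z ∉ Ioo x y

/-- `x` is matched to a point on its right. -/
def RightOriented (M : SimpleGraph ℝ) (x : ℝ) : Prop := ∃ y, M.Adj x y ∧ x < y

/-- `x` is matched to a point on its left. -/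
def LeftOriented (M : SimpleGraph ℝ) (x : ℝ) : Prop := ∃ y, M.Adj x y ∧ y < x

/-- `x` is right-oriented and `y` is the `i`-th left-oriented point to the right of `x`. -/
def Shifted (M : SimpleGraph ℝ) (i : ℕ) (x y : ℝ) : Prop :=
  RightOriented M x ∧ LeftOriented M y ∧ x < y ∧
    {z | LeftOriented M z ∧ x < z ∧ z ≤ y}.encard = i

/-- At each level `i ≥ 1` one of the two adjacent matchings of the points of degree at least `i`
is picked by a fair coin. The coins of the levels are independent of each other and jointly
independent of the marked points. The two matchings are told apart by whether or not the origin
lies between two matched points. -/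
def IsUniformAdjacentChoice {Ω : Type*} [MeasurableSpace Ω] (P : Measure Ω)
    (X : ℕ → Ω → ℝ) (D : ℕ → Ω → ℕ) (M : ℕ → Ω → SimpleGraph ℝ) : Prop :=
  (∀ᵐ ω ∂P, ∀ i, 1 ≤ i → IsAdjacentMatching (level (markedSet X D ω) i) (M i ω)) ∧
  ∃ coin : ℕ → Ω → Bool,
    (∀ i, Measurable (coin i)) ∧
    (∀ i, P {ω | coin i ω = true} = 1 / 2) ∧
    iIndepFun coin P ∧
    IndepFun (fun ω => ((fun n => X n ω), (fun n => D n ω))) (fun ω i => coin i ω) P ∧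
    ∀ᵐ ω ∂P, ∀ i, 1 ≤ i → (level (markedSet X D ω) i).Nonempty →
      (coin i ω = true ↔ ∃ x y, (M i ω).Adj x y ∧ x < 0 ∧ 0 < y)

/-- A set of marked points together with a pairing of stubs; the stub `(x, i)` is the `i`-th stub
of the vertex `x`. -/
structure Config where
  marked : Set (ℝ × ℕ)
  pair : ℝ × ℕ → ℝ × ℕ → Prop

/-- The vertex set. -/
def Config.pts (c : Config) : Set ℝ := {x | ∃ d, (x, d) ∈ c.marked}

/-- The configuration seen from `t`: everything is translated by `-t`. -/
def Config.shift (c : Config) (t : ℝ) : Config where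
  marked := {p | (p.1 + t, p.2) ∈ c.marked}
  pair s s' := c.pair (s.1 + t, s.2) (s'.1 + t, s'.2)

/-- The pairing of shifted adjacent matching built on the matchings `M i` of the levels. -/
def samConfig (A : Set (ℝ × ℕ)) (M : ℕ → SimpleGraph ℝ) : Config where
  marked := A
  pair s s' := s.2 = s'.2 ∧ 1 ≤ s.2 ∧ (Shifted (M s.2) s.2 s.1 s'.1 ∨ Shifted (M s.2) s.2 s'.1 s.1)

/-- The random configuration of shifted adjacent matching. -/
def sam {Ω : Type*} (X : ℕ → Ω → ℝ) (D : ℕ → Ω → ℕ) (M : ℕ → Ω → SimpleGraph ℝ) (ω : Ω) :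
    Config :=
  samConfig (markedSet X D ω) fun i => M i ω

/-- The length of the edge at the `i`-th stub of the origin (`0` if there is none). -/
def edgeLength (i : ℕ) (c : Config) : ℝ≥0∞ := ∑' s : {s : ℝ × ℕ | c.pair (0, i) s}, edist 0 s.1.1

/-- The total length of all edges at the origin. -/
def totalLength (c : Config) : ℝ≥0∞ := ∑' i, edgeLength i c

/-- The origin is a vertex of degree at least `i`. -/
def originDegGe (i : ℕ) : Set Config := {c | (0 : ℝ) ∈ level c.marked i}

/-! ## The Palm version -/

/-- Expectation of `f` under the Palm version, with respect to its vertices, of a stationary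
random configuration `C`:
`E*[f] = E[∑ f (C seen from x)] / E[number of x]`, over the vertices `x` in `[0, 1)`. -/
def palmExp {Ω : Type*} [MeasurableSpace Ω] (P : Measure Ω) (C : Ω → Config)
    (f : Config → ℝ≥0∞) : ℝ≥0∞ :=
  (∫⁻ ω, ∑' x : ↥((C ω).pts ∩ Ico 0 1), f ((C ω).shift x) ∂P) /
    ∫⁻ ω, (((C ω).pts ∩ Ico 0 1).encard : ℝ≥0∞) ∂P

/-- Conditional expectation `E*[f | A] = E*[f ; A] / P*(A)` under the Palm version. -/
def palmCondExp {Ω : Type*} [MeasurableSpace Ω] (P : Measure Ω) (C : Ω → Config)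
    (f : Config → ℝ≥0∞) (A : Set Config) : ℝ≥0∞ :=
  palmExp P C (A.indicator f) / palmExp P C (A.indicator 1)

end SAM

end

/-! Fix a level `i`, let `S` be the points of degree at least `i`, and put `m = 2 * i - 1`.
Orientations alternate along `S`, so the `i`-th left-oriented point to the right of a right-oriented
`x` is the `m`-th point of `S` after `x` (`IsAdjacentMatching.shifted_iff`). The edge length at `x`
is therefore the measure of the `t ≥ x` for which `[x, t]` holds at most `m` points of `S`, and
symmetrically for left-oriented points (`edgeLength_shift_of_right`, `edgeLength_shift_of_left`).

By mass transport, the mean total distance from the points of `S` in `[0, 1)` to their `m`-th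
successors is `m`. Indeed, exchange the integral over `t` with the expectation. The points of `S ∩
[0, t]` with at most `m` points of `S` in `[x, t]` are the last `m` of them, so those in `[0, 1)`
number `min (#S ∩ [0, t]) m - min (#S ∩ [1, t]) m`. By stationarity the mean is `φ t - φ (t - 1)`,
where `φ` increases from `0` to `m`, and the integral telescopes to `m`
(`lintegral_eq_of_add_shift_eq`, `lintegral_reachRight`, `lintegral_reachLeft`).

The coin only decides which parity class of `S` is left-oriented (`left_iff_odd`). It is fair and
independent of the marked points, so the mean edge length is half the sum of the leftward and
rightward means, again `m` (`alternatingLength_add`,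
`IsUniformAdjacentChoice.lintegral_edgeLength`). Dividing by the Palm probability of `D ≥ i` gives
the conditional mean. Summing over the levels charged by `F` gives `1 + 3 + ⋯ + (2u - 1) = u ^ 2`,
or a divergent series if the support is unbounded. -/

noncomputable section

namespace SAM

/-! ### Adjacent matchings of a locally finite set -/

/-- A locally finite set of reals that is unbounded in both directions. -/
structure IsBiinfinite (S : Set ℝ) : Prop where
  finite : ∀ a b, (S ∩ Icc a b).Finite
  above : ∀ a, ∃ x ∈ S, a < x
  below : ∀ a, ∃ x ∈ S, x < a

section Matching

variable {S : Set ℝ} {M : SimpleGraph ℝ} {x y : ℝ}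

lemma IsAdjacentMatching.mem_right (h : IsAdjacentMatching S M) (hxy : M.Adj x y) : y ∈ S :=
  h.mem y x hxy.symm

lemma IsAdjacentMatching.mem_of_rightOriented (h : IsAdjacentMatching S M)
    (hx : RightOriented M x) : x ∈ S := by
  obtain ⟨y, hy, -⟩ := hx
  exact h.mem _ _ hy

lemma IsAdjacentMatching.mem_of_leftOriented (h : IsAdjacentMatching S M)
    (hx : LeftOriented M x) : x ∈ S := by
  obtain ⟨y, hy, -⟩ := hx
  exact h.mem _ _ hy

lemma IsAdjacentMatching.unique (h : IsAdjacentMatching S M) {z : ℝ} (hy : M.Adj x y)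
    (hz : M.Adj x z) : y = z :=
  (h.existsUnique x (h.mem _ _ hy)).unique hy hz

lemma IsAdjacentMatching.not_left_of_right (h : IsAdjacentMatching S M)
    (hx : RightOriented M x) : ¬ LeftOriented M x := by
  rintro ⟨z, hz, hzx⟩
  obtain ⟨y, hy, hxy⟩ := hx
  have := h.unique hy hz
  linarith

lemma IsAdjacentMatching.right_or_left (h : IsAdjacentMatching S M) (hx : x ∈ S) :
    RightOriented M x ∨ LeftOriented M x := by
  obtain ⟨y, hy, -⟩ := h.existsUnique x hx
  rcases lt_or_gt_of_ne hy.ne with h1 | h1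
  · exact Or.inl ⟨y, hy, h1⟩
  · exact Or.inr ⟨y, hy, h1⟩

lemma IsAdjacentMatching.not_left_iff (h : IsAdjacentMatching S M) (hx : x ∈ S) :
    ¬ LeftOriented M x ↔ RightOriented M x :=
  ⟨fun h' => (h.right_or_left hx).resolve_right h', h.not_left_of_right⟩

/-- Between a right-oriented point `x` and a point `y`, the points other than a right-oriented `y`
are the left-oriented ones together with their partners. -/
lemma IsAdjacentMatching.ncard_diff_right (h : IsAdjacentMatching S M) (hx : RightOriented M x)
    (hyS : y ∈ S) (hfin : (S ∩ Icc x y).Finite) :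
    ((S ∩ Icc x y) \ {z | z = y ∧ RightOriented M y}).ncard =
      2 * {z | LeftOriented M z ∧ x < z ∧ z ≤ y}.ncard := by
  -- `f` sends a point of `S` to its partner; off `S` its value is irrelevant.
  have hex : ∀ z, ∃ w, z ∈ S → M.Adj z w := fun z => by
    by_cases hz : z ∈ S
    · obtain ⟨w, hw, -⟩ := h.existsUnique z hz
      exact ⟨w, fun _ => hw⟩
    · exact ⟨0, fun h => absurd h hz⟩
  choose f hf using hex
  set A := {z | LeftOriented M z ∧ x < z ∧ z ≤ y} with hA
  have hAS : ∀ z ∈ A, M.Adj z (f z) ∧ f z < z ∧ x ≤ f z := by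
    rintro z ⟨hz, hxz, hzy⟩
    have hzS := h.mem_of_leftOriented hz
    obtain ⟨w, hw, hwz⟩ := hz
    have e := h.unique hw (hf z hzS)
    subst e
    refine ⟨hw, hwz, ?_⟩
    by_contra hlt
    exact h.adjacent _ _ hw.symm x (h.mem_of_rightOriented hx) ⟨not_le.mp hlt, hxz⟩
  have hAsub : A ⊆ S ∩ Icc x y := fun z hz =>
    ⟨h.mem_of_leftOriented hz.1, hz.2.1.le, hz.2.2⟩
  have hAfin : A.Finite := hfin.subset hAsub
  have hinj : InjOn f A := by
    intro a ha b hb hab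
    have h1 := (hAS a ha).1.symm
    have h2 := (hAS b hb).1.symm
    rw [← hab] at h2
    exact h.unique h1 h2
  -- No pair crosses `x` or `y`, since neither endpoint can lie strictly between matched points.
  -- Only a right-oriented `y` has its partner outside `[x, y]`.
  have key : (S ∩ Icc x y) \ {z | z = y ∧ RightOriented M y} = A ∪ f '' A := by
    ext z
    constructor
    · rintro ⟨⟨hzS, hxz, hzy⟩, hne⟩
      rcases h.right_or_left hzS with hz | hz
      · right
        have hzy' : z < y := lt_of_le_of_ne hzy fun e => hne ⟨e, e ▸ hz⟩
        obtain ⟨w, hw, hzw⟩ := hz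
        have hwy : w ≤ y := by
          by_contra hlt
          exact h.adjacent _ _ hw y hyS ⟨hzy', not_le.mp hlt⟩
        have hwA : w ∈ A := ⟨⟨z, hw.symm, hzw⟩, hxz.trans_lt hzw, hwy⟩
        exact ⟨w, hwA, h.unique (hAS w hwA).1 hw.symm⟩
      · left
        refine ⟨hz, lt_of_le_of_ne hxz ?_, hzy⟩
        rintro rfl
        exact h.not_left_of_right hx hz
    · rintro (hz | ⟨w, hw, rfl⟩)
      · exact ⟨hAsub hz, fun e => h.not_left_of_right e.2 (e.1 ▸ hz.1)⟩
      · obtain ⟨h1, h2, h3⟩ := hAS w hw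
        refine ⟨⟨h.mem_right h1, h3, h2.le.trans hw.2.2⟩, fun e => ?_⟩
        have := hw.2.2
        have := e.1
        linarith
  rw [key, ncard_union_eq _ hAfin (hAfin.image f), hinj.ncard_image, two_mul]
  rw [Set.disjoint_left]
  rintro z hz ⟨w, hw, rfl⟩
  obtain ⟨h1, h2, h3⟩ := hAS w hw
  exact h.not_left_of_right ⟨w, h1.symm, h2⟩ hz.1

lemma IsAdjacentMatching.ncard_of_right_left (h : IsAdjacentMatching S M)
    (hx : RightOriented M x) (hy : LeftOriented M y) (hfin : (S ∩ Icc x y).Finite) :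
    (S ∩ Icc x y).ncard = 2 * {z | LeftOriented M z ∧ x < z ∧ z ≤ y}.ncard := by
  rw [← h.ncard_diff_right hx (h.mem_of_leftOriented hy) hfin]
  congr 1
  ext z
  simp only [mem_sdiff, mem_ofPred_eq, iff_self_and]
  exact fun _ e => h.not_left_of_right e.2 hy

/-- The points of `[x, y]` split into matched pairs, except that a right-oriented `y` is left over
and makes the count odd. -/
lemma IsAdjacentMatching.left_iff_even (h : IsAdjacentMatching S M)
    (hx : RightOriented M x) (hyS : y ∈ S) (hxy : x ≤ y) (hfin : (S ∩ Icc x y).Finite) :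
    LeftOriented M y ↔ Even (S ∩ Icc x y).ncard := by
  constructor
  · intro hy
    rw [h.ncard_of_right_left hx hy hfin]
    exact even_two_mul _
  · intro he
    by_contra hy
    rw [h.not_left_iff hyS] at hy
    have h1 := h.ncard_diff_right hx hyS hfin
    have h2 : {z | z = y ∧ RightOriented M y} = {y} := by
      ext z
      simp [hy]
    rw [h2] at h1
    have h3 := ncard_sdiff_singleton_add_one (s := S ∩ Icc x y) ⟨hyS, hxy, le_rfl⟩ hfin
    rw [h1] at h3
    rw [← h3] at he
    exact absurd he (by simp)

/-- A left-oriented point and a point to its left: the mirror image of `left_iff_even`. -/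
lemma IsAdjacentMatching.right_iff_even (h : IsAdjacentMatching S M) (hS : IsBiinfinite S)
    (hy : LeftOriented M y) (hxS : x ∈ S) (hxy : x ≤ y) :
    RightOriented M x ↔ Even (S ∩ Icc x y).ncard := by
  constructor
  · intro hx
    rw [h.ncard_of_right_left hx hy (hS.finite _ _)]
    exact even_two_mul _
  · intro he
    refine (h.right_or_left hxS).resolve_right ?_
    -- Were `x` left-oriented, its partner `a` would be the preceding point of `S`, and `[a, y]`
    -- would have one point more than `[x, y]`, although both counts are even.
    rintro ⟨a, ha, hax⟩
    have haR : RightOriented M a := ⟨x, ha.symm, hax⟩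
    have h1 := h.ncard_of_right_left haR hy (hS.finite _ _)
    have h2 : S ∩ Icc a y = insert a (S ∩ Icc x y) := by
      ext z
      constructor
      · rintro ⟨hz, haz, hzy⟩
        rcases haz.eq_or_lt with rfl | haz
        · exact mem_insert _ _
        · refine mem_insert_of_mem _ ⟨hz, ?_, hzy⟩
          by_contra hlt
          exact h.adjacent _ _ ha.symm z hz ⟨haz, not_le.mp hlt⟩
      · rintro (rfl | ⟨hz, hxz, hzy⟩)
        · exact ⟨h.mem_of_rightOriented haR, le_rfl, hax.le.trans hxy⟩
        · exact ⟨hz, hax.le.trans hxz, hzy⟩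
    rw [h2, ncard_insert_of_notMem (fun hh => hax.not_ge hh.2.1) (hS.finite _ _)] at h1
    obtain ⟨k, hk⟩ := he
    omega

/-- Each left-oriented point of `(x, y]` brings its partner, so counting `i` of them amounts to
counting `2 * i` points of `S`, whatever their orientation. -/
lemma IsAdjacentMatching.shifted_iff (h : IsAdjacentMatching S M) (hS : IsBiinfinite S) {i : ℕ} :
    Shifted M i x y ↔
      RightOriented M x ∧ LeftOriented M y ∧ x < y ∧ (S ∩ Icc x y).ncard = 2 * i := by
  unfold Shifted
  refine and_congr_right fun hx => and_congr_right fun hy => and_congr_right fun hxy => ?_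
  rw [h.ncard_of_right_left hx hy (hS.finite _ _)]
  have hfin : {z | LeftOriented M z ∧ x < z ∧ z ≤ y}.Finite :=
    (hS.finite x y).subset fun z hz => ⟨h.mem_of_leftOriented hz.1, hz.2.1.le, hz.2.2⟩
  rw [← hfin.cast_ncard_eq]
  norm_cast
  omega

lemma IsBiinfinite.exists_ncard_right (hS : IsBiinfinite S) (hx : x ∈ S) (n : ℕ) :
    ∃ y ∈ S, x ≤ y ∧ (S ∩ Icc x y).ncard = n + 1 := by
  induction n with
  | zero =>
    refine ⟨x, hx, le_rfl, ?_⟩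
    rw [Icc_self, inter_eq_right.mpr (singleton_subset_iff.mpr hx), ncard_singleton]
  | succ n ih =>
    obtain ⟨y, hy, hxy, hn⟩ := ih
    obtain ⟨z, hz, hyz⟩ := hS.above y
    obtain ⟨w, ⟨hw, hyw, hwz⟩, hmin⟩ := Set.exists_min_image (S ∩ Ioc y z) id
      ((hS.finite y z).subset fun a ha => ⟨ha.1, ha.2.1.le, ha.2.2⟩) ⟨z, hz, hyz, le_rfl⟩
    refine ⟨w, hw, hxy.trans hyw.le, ?_⟩
    have : S ∩ Icc x w = insert w (S ∩ Icc x y) := by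
      ext a
      constructor
      · rintro ⟨ha, hxa, haw⟩
        rcases le_or_gt a y with hay | hay
        · exact mem_insert_of_mem _ ⟨ha, hxa, hay⟩
        · left
          exact le_antisymm haw (hmin a ⟨ha, hay, haw.trans hwz⟩)
      · rintro (rfl | ⟨ha, hxa, hay⟩)
        · exact ⟨hw, hxy.trans hyw.le, le_rfl⟩
        · exact ⟨ha, hxa, hay.trans hyw.le⟩
    rw [this, ncard_insert_of_notMem (fun hh => hyw.not_ge hh.2.2) (hS.finite _ _), hn]

lemma IsBiinfinite.exists_ncard_left (hS : IsBiinfinite S) (hx : x ∈ S) (n : ℕ) :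
    ∃ y ∈ S, y ≤ x ∧ (S ∩ Icc y x).ncard = n + 1 := by
  induction n with
  | zero =>
    refine ⟨x, hx, le_rfl, ?_⟩
    rw [Icc_self, inter_eq_right.mpr (singleton_subset_iff.mpr hx), ncard_singleton]
  | succ n ih =>
    obtain ⟨y, hy, hxy, hn⟩ := ih
    obtain ⟨z, hz, hyz⟩ := hS.below y
    obtain ⟨w, ⟨hw, hzw, hwy⟩, hmax⟩ := Set.exists_max_image (S ∩ Ico z y) id
      ((hS.finite z y).subset fun a ha => ⟨ha.1, ha.2.1, ha.2.2.le⟩) ⟨z, hz, le_rfl, hyz⟩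
    refine ⟨w, hw, hwy.le.trans hxy, ?_⟩
    have : S ∩ Icc w x = insert w (S ∩ Icc y x) := by
      ext a
      constructor
      · rintro ⟨ha, hwa, hax⟩
        rcases le_or_gt y a with hay | hay
        · exact mem_insert_of_mem _ ⟨ha, hay, hax⟩
        · left
          exact le_antisymm (hmax a ⟨ha, hzw.trans hwa, hay⟩) hwa
      · rintro (rfl | ⟨ha, hya, hax⟩)
        · exact ⟨hw, le_rfl, hwy.le.trans hxy⟩
        · exact ⟨ha, hwy.le.trans hya, hax⟩
    rw [this, ncard_insert_of_notMem (fun hh => hwy.not_ge hh.2.1) (hS.finite _ _), hn]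

/-- The count of `S ∩ [x, t]` is a step function of `t` that jumps from `m` to `m + 1` at `y`. -/
lemma IsBiinfinite.ncard_le_iff_right (hS : IsBiinfinite S) (hy : y ∈ S) (hxy : x ≤ y) {m : ℕ}
    (hm : (S ∩ Icc x y).ncard = m + 1) (t : ℝ) : (S ∩ Icc x t).ncard ≤ m ↔ t < y := by
  constructor
  · intro h
    by_contra hlt
    have := ncard_le_ncard (s := S ∩ Icc x y) (t := S ∩ Icc x t)
      (fun a ha => ⟨ha.1, ha.2.1, ha.2.2.trans (not_lt.mp hlt)⟩) (hS.finite _ _)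
    omega
  · intro hty
    have := ncard_lt_ncard (s := S ∩ Icc x t) (t := S ∩ Icc x y)
      ⟨fun a ha => ⟨ha.1, ha.2.1, ha.2.2.trans hty.le⟩,
        fun h => hty.not_ge (h ⟨hy, hxy, le_rfl⟩).2.2⟩ (hS.finite _ _)
    omega

lemma IsBiinfinite.ncard_le_iff_left (hS : IsBiinfinite S) (hy : y ∈ S) (hxy : y ≤ x) {m : ℕ}
    (hm : (S ∩ Icc y x).ncard = m + 1) (t : ℝ) : (S ∩ Icc t x).ncard ≤ m ↔ y < t := by
  constructor
  · intro h
    by_contra hlt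
    have := ncard_le_ncard (s := S ∩ Icc y x) (t := S ∩ Icc t x)
      (fun a ha => ⟨ha.1, (not_lt.mp hlt).trans ha.2.1, ha.2.2⟩) (hS.finite _ _)
    omega
  · intro hty
    have := ncard_lt_ncard (s := S ∩ Icc t x) (t := S ∩ Icc y x)
      ⟨fun a ha => ⟨ha.1, hty.le.trans ha.2.1, ha.2.2⟩,
        fun h => hty.not_ge (h ⟨hy, le_rfl, hxy⟩).2.1⟩ (hS.finite _ _)
    omega

/-- The matching in which the origin lies between two matched points is the one in which the
points of odd index on the positive half-line are left-oriented. -/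
lemma IsAdjacentMatching.left_iff_odd (h : IsAdjacentMatching S M) (hS : IsBiinfinite S)
    (h0 : (0 : ℝ) ∉ S) (hx : x ∈ S) (hx0 : 0 < x) :
    LeftOriented M x ↔
      (Odd (S ∩ Ioc 0 x).ncard ↔ ∃ a b, M.Adj a b ∧ a < 0 ∧ 0 < b) := by
  have hfin : (S ∩ Ioc 0 x).Finite := (hS.finite 0 x).subset fun a ha => ⟨ha.1, ha.2.1.le, ha.2.2⟩
  by_cases hC : ∃ a b, M.Adj a b ∧ a < 0 ∧ 0 < b
  -- The left end `a` of the pair around the origin is right-oriented, and it is the only point of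
  -- `S ∩ [a, x]` outside `(0, x]`. This reverses the parity.
  · rw [iff_true_right hC]
    obtain ⟨a, b, hab, ha, hb⟩ := hC
    have haR : RightOriented M a := ⟨b, hab, ha.trans hb⟩
    rw [h.left_iff_even haR hx (ha.trans hx0).le (hS.finite _ _)]
    have : S ∩ Icc a x = insert a (S ∩ Ioc 0 x) := by
      ext z
      constructor
      · rintro ⟨hz, haz, hzx⟩
        rcases haz.eq_or_lt with rfl | haz
        · exact mem_insert _ _
        · refine mem_insert_of_mem _ ⟨hz, hb.trans_le ?_, hzx⟩
          by_contra hlt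
          exact h.adjacent _ _ hab z hz ⟨haz, not_le.mp hlt⟩
      · rintro (rfl | ⟨hz, hxz, hzy⟩)
        · exact ⟨h.mem_of_rightOriented haR, le_rfl, (ha.trans hx0).le⟩
        · exact ⟨hz, (ha.trans hxz).le, hzy⟩
    rw [this, ncard_insert_of_notMem (fun hh => ha.not_gt hh.2.1) hfin]
    rw [Nat.even_add_one, Nat.not_even_iff_odd]
  · rw [iff_false_right hC, Nat.not_odd_iff_even]
    -- With no pair around the origin, the first positive point `b` is right-oriented and serves as
    -- the reference point.
    obtain ⟨b, ⟨hb, hb0, hbx⟩, hmin⟩ := Set.exists_min_image (S ∩ Ioc 0 x) id hfin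
      ⟨x, hx, hx0, le_rfl⟩
    have hbR : RightOriented M b := by
      refine (h.right_or_left hb).resolve_right ?_
      rintro ⟨a, ha, hab⟩
      have haS := h.mem_right ha
      refine hC ⟨a, b, ha.symm, ?_, hb0⟩
      rcases lt_trichotomy a 0 with h1 | rfl | h1
      · exact h1
      · exact absurd haS h0
      · exact absurd (hmin a ⟨haS, h1, hab.le.trans hbx⟩) (not_le.mpr hab)
    rw [h.left_iff_even hbR hx hbx (hS.finite _ _)]
    have : S ∩ Icc b x = S ∩ Ioc 0 x := by
      ext z
      exact ⟨fun hz => ⟨hz.1, hb0.trans_le hz.2.1, hz.2.2⟩,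
        fun hz => ⟨hz.1, hmin z hz, hz.2.2⟩⟩
    rw [this]

end Matching

/-! ### Edge lengths in shifted adjacent matching -/

section EdgeLength

variable {A : Set (ℝ × ℕ)} {M : ℕ → SimpleGraph ℝ} {i : ℕ} {x : ℝ}

/-- The case `i = 0` is included because `totalLength` also sums over `i = 0`, where there are no
stubs. -/
lemma edgeLength_shift_eq_zero (h : i = 0 ∨ IsAdjacentMatching (level A i) (M i))
    (hx : i = 0 ∨ x ∉ level A i) : edgeLength i ((samConfig A M).shift x) = 0 := by
  unfold edgeLength
  have : {s : ℝ × ℕ | ((samConfig A M).shift x).pair (0, i) s} = ∅ := by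
    ext ⟨s, j⟩
    simp only [Config.shift, samConfig, mem_ofPred_eq, mem_empty_iff_false, iff_false, zero_add]
    rintro ⟨-, hi, hs⟩
    have hi' : i ≠ 0 := by omega
    replace h := h.resolve_left hi'
    refine hx.resolve_left hi' ?_
    rcases hs with hs | hs
    · exact h.mem_of_rightOriented hs.1
    · exact h.mem_of_leftOriented hs.2.1
  rw [this, tsum_empty]

lemma edgeLength_shift_of_unique (hi : 1 ≤ i) {y : ℝ}
    (h : ∀ z, (Shifted (M i) i x z ∨ Shifted (M i) i z x) ↔ z = y) :
    edgeLength i ((samConfig A M).shift x) = edist x y := by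
  unfold edgeLength
  have : {s : ℝ × ℕ | ((samConfig A M).shift x).pair (0, i) s} = {(y - x, i)} := by
    ext ⟨s, j⟩
    simp only [Config.shift, samConfig, mem_ofPred_eq, mem_singleton_iff, zero_add, Prod.mk.injEq,
      h, hi, true_and]
    constructor
    · rintro ⟨rfl, rfl⟩
      simp
    · rintro ⟨rfl, rfl⟩
      simp
  rw [this, tsum_singleton (y - x, i) (fun s : ℝ × ℕ => edist 0 s.1)]
  rw [edist_dist, edist_dist, dist_comm, dist_zero_right, dist_comm x, Real.dist_eq,
    Real.norm_eq_abs]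

/-- The partner is the point `y` with `2 * i` points of `S` in `[x, y]`. Writing the distance as the
volume of a set of `t` prepares the exchange of integrals. -/
lemma edgeLength_shift_of_right (h : IsAdjacentMatching (level A i) (M i))
    (hS : IsBiinfinite (level A i)) (hi : 1 ≤ i) (hx : RightOriented (M i) x) :
    edgeLength i ((samConfig A M).shift x) =
      volume {t | x ≤ t ∧ (level A i ∩ Icc x t).ncard ≤ 2 * i - 1} := by
  set S := level A i
  have hxS := h.mem_of_rightOriented hx
  obtain ⟨y, hy, hxy, hn⟩ := hS.exists_ncard_right hxS (2 * i - 1)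
  have hn2 : (S ∩ Icc x y).ncard = 2 * i := by omega
  have hyL : LeftOriented (M i) y := by
    rw [h.left_iff_even hx hy hxy (hS.finite _ _), hn2]
    exact even_two_mul i
  have hlt : x < y := lt_of_le_of_ne hxy fun e => h.not_left_of_right hx (e ▸ hyL)
  have key := hS.ncard_le_iff_right hy hxy hn
  have hvol : {t | x ≤ t ∧ (S ∩ Icc x t).ncard ≤ 2 * i - 1} = Ico x y := by
    ext t
    simp only [mem_ofPred_eq, mem_Ico, key]
  rw [hvol, Real.volume_Ico, edgeLength_shift_of_unique hi (y := y), edist_dist, dist_comm,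
    Real.dist_eq, abs_of_pos (sub_pos.mpr hlt)]
  intro z
  rw [h.shifted_iff hS, h.shifted_iff hS]
  constructor
  · rintro (⟨-, hz, hxz, hzn⟩ | ⟨-, hx', -⟩)
    · rcases lt_trichotomy z y with hh | hh | hh
      · have := (key z).mpr hh
        omega
      · exact hh
      · have h2 := (hS.ncard_le_iff_right (h.mem_of_leftOriented hz) hxz.le
          (m := 2 * i - 1) (by omega) y).mpr hh
        omega
    · exact absurd hx' (h.not_left_of_right hx)
  · rintro rfl
    exact Or.inl ⟨hx, hyL, hlt, hn2⟩

lemma edgeLength_shift_of_left (h : IsAdjacentMatching (level A i) (M i))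
    (hS : IsBiinfinite (level A i)) (hi : 1 ≤ i) (hx : LeftOriented (M i) x) :
    edgeLength i ((samConfig A M).shift x) =
      volume {t | t ≤ x ∧ (level A i ∩ Icc t x).ncard ≤ 2 * i - 1} := by
  set S := level A i
  have hxS := h.mem_of_leftOriented hx
  obtain ⟨y, hy, hxy, hn⟩ := hS.exists_ncard_left hxS (2 * i - 1)
  have hn2 : (S ∩ Icc y x).ncard = 2 * i := by omega
  have hyR : RightOriented (M i) y := by
    rw [h.right_iff_even hS hx hy hxy, hn2]
    exact even_two_mul i
  have hlt : y < x := lt_of_le_of_ne hxy fun e => h.not_left_of_right hyR (e ▸ hx)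
  have key := hS.ncard_le_iff_left hy hxy hn
  have hvol : {t | t ≤ x ∧ (S ∩ Icc t x).ncard ≤ 2 * i - 1} = Ioc y x := by
    ext t
    simp only [mem_ofPred_eq, mem_Ioc, key, and_comm]
  rw [hvol, Real.volume_Ioc, edgeLength_shift_of_unique hi (y := y), edist_dist,
    Real.dist_eq, abs_of_pos (sub_pos.mpr hlt)]
  intro z
  rw [h.shifted_iff hS, h.shifted_iff hS]
  constructor
  · rintro (⟨hx', -⟩ | ⟨hz, -, hxz, hzn⟩)
    · exact absurd hx (h.not_left_of_right hx')
    · rcases lt_trichotomy z y with hh | hh | hh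
      · have h2 := (hS.ncard_le_iff_left (h.mem_of_rightOriented hz) hxz.le
          (m := 2 * i - 1) (by omega) y).mpr hh
        omega
      · exact hh
      · have := (key z).mpr hh
        omega
  · rintro rfl
    exact Or.inr ⟨hyR, hx, hlt, hn2⟩

end EdgeLength

/-! ### Counts of points and of points of large degree -/

/-- The number of terms of the sequence `x` in `B`. -/
def pointCount (B : Set ℝ) (x : ℕ → ℝ) : ℝ≥0∞ := ∑' n, B.indicator 1 (x n)

/-- The number of indices of points in `B` with at least `i` stubs. -/
def stubCount (i : ℕ) (B : Set ℝ) (z : (ℕ → ℝ) × (ℕ → ℕ)) : ℝ≥0∞ :=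
  ∑' n, B.indicator 1 (z.1 n) * (Ici i).indicator 1 (z.2 n)

lemma pointCount_eq_encard (B : Set ℝ) (x : ℕ → ℝ) :
    pointCount B x = ({n | x n ∈ B}.encard : ℝ≥0∞) := by
  rw [← ENNReal.tsum_set_one, tsum_subtype {n | x n ∈ B} (fun _ => (1 : ℝ≥0∞))]
  rfl

lemma stubCount_eq_encard (i : ℕ) (B : Set ℝ) (z : (ℕ → ℝ) × (ℕ → ℕ)) :
    stubCount i B z = ({n | z.1 n ∈ B ∧ i ≤ z.2 n}.encard : ℝ≥0∞) := by
  rw [← ENNReal.tsum_set_one, tsum_subtype {n | z.1 n ∈ B ∧ i ≤ z.2 n} (fun _ => (1 : ℝ≥0∞))]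
  refine tsum_congr fun n => ?_
  by_cases h1 : z.1 n ∈ B <;> by_cases h2 : i ≤ z.2 n <;> simp [h1, h2]

lemma stubCount_mono (i : ℕ) {B B' : Set ℝ} (h : B ⊆ B') (z : (ℕ → ℝ) × (ℕ → ℕ)) :
    stubCount i B z ≤ stubCount i B' z := by
  rw [stubCount_eq_encard, stubCount_eq_encard]
  exact ENat.toENNReal_mono (encard_le_encard fun n hn => ⟨h hn.1, hn.2⟩)

lemma measurable_pointCount {B : Set ℝ} (hB : MeasurableSet B) : Measurable (pointCount B) := by
  unfold pointCount
  exact Measurable.tsum fun n =>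
    (measurable_one.indicator hB).comp (measurable_pi_apply n)

lemma measurable_stubCount (i : ℕ) {B : Set ℝ} (hB : MeasurableSet B) :
    Measurable (stubCount i B) := by
  unfold stubCount
  refine Measurable.tsum fun n => Measurable.mul ?_ ?_
  · exact (measurable_one.indicator hB).comp ((measurable_pi_apply n).comp measurable_fst)
  · exact (measurable_one.indicator measurableSet_Ici).comp
      ((measurable_pi_apply n).comp measurable_snd)

/-- The Poisson weights satisfy `(k + 1) p (k + 1) = r p k`, and the `p k` sum to `1`. -/
lemma lintegral_poissonMeasure_cast (r : NNReal) :
    ∫⁻ k : ℕ, (k : ℝ≥0∞) ∂poissonMeasure r = r := by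
  rw [lintegral_countable', tsum_eq_zero_add' ENNReal.summable]
  simp only [Nat.cast_zero, zero_mul, zero_add]
  have h : ∀ k : ℕ, ((k + 1 : ℕ) : ℝ≥0∞) * poissonMeasure r {k + 1} =
      r * poissonMeasure r {k} := by
    intro k
    rw [poissonMeasure_singleton, poissonMeasure_singleton, ← ENNReal.ofReal_natCast,
      ← ENNReal.ofReal_coe_nnreal, ← ENNReal.ofReal_mul (by positivity),
      ← ENNReal.ofReal_mul (by positivity), Nat.factorial_succ]
    congr 1
    push_cast
    field_simp
    ring
  simp_rw [h]
  rw [ENNReal.tsum_mul_left]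
  have := (lintegral_countable' (μ := poissonMeasure r) (fun _ : ℕ => (1 : ℝ≥0∞)))
  simp only [one_mul, lintegral_one, measure_univ] at this
  rw [← this, mul_one]

/-! ### Laws of counts and almost sure properties of the marked process -/

section PoissonPoints

variable {Ω : Type*} [MeasurableSpace Ω] {P : Measure Ω}
  {X : ℕ → Ω → ℝ} {D : ℕ → Ω → ℕ} {F : PMF ℕ}

lemma IsPoissonProcess.measurable_pi (h : IsPoissonProcess P X) :
    Measurable fun ω n => X n ω :=
  measurable_pi_lambda _ h.measurable

lemma encard_range_inter {x : ℕ → ℝ} (hx : Function.Injective x) (B : Set ℝ) :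
    (range x ∩ B).encard = {n | x n ∈ B}.encard := by
  rw [inter_comm, ← image_preimage_eq_inter_range, hx.injOn.encard_image]
  rfl

lemma IsPoissonProcess.measure_pointCount_eq (h : IsPoissonProcess P X) {B : Set ℝ}
    (hB : MeasurableSet B) (hB' : volume B < ∞) (k : ℕ) :
    P {ω | pointCount B (fun n => X n ω) = k} = poissonMeasure (volume B).toNNReal {k} := by
  rw [← h.count_law B hB hB' k]
  apply measure_congr
  filter_upwards [h.injective] with ω hω
  apply propext
  change (pointCount B (fun n => X n ω) = k) ↔ (range (fun n => X n ω) ∩ B).encard = k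
  rw [encard_range_inter hω, pointCount_eq_encard, ← ENat.toENNReal_coe, ENat.toENNReal_inj]

lemma IsPoissonProcess.measurable_pointCount (h : IsPoissonProcess P X) {B : Set ℝ}
    (hB : MeasurableSet B) : Measurable fun ω => pointCount B (fun n => X n ω) :=
  (SAM.measurable_pointCount hB).comp h.measurable_pi

lemma IsMarkedPoisson.measurable_marks (h : IsMarkedPoisson P F X D) :
    Measurable fun ω n => D n ω :=
  measurable_pi_lambda _ h.measurable_mark

lemma IsMarkedPoisson.measurable_pair (h : IsMarkedPoisson P F X D) :
    Measurable fun ω => ((fun n => X n ω), (fun n => D n ω)) :=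
  h.ground.measurable_pi.prodMk h.measurable_marks

lemma IsMarkedPoisson.measure_le_mark (h : IsMarkedPoisson P F X D) (i n : ℕ) :
    P {ω | i ≤ D n ω} = F.toMeasure (Ici i) := by
  rw [← h.mark_law n, Measure.map_apply (h.measurable_mark n) measurableSet_Ici]
  rfl

/-- A set containing bounded sets of arbitrarily large volume contains a point of the process. -/
lemma IsPoissonProcess.ae_exists_mem (h : IsPoissonProcess P X) {B : Set ℝ} {C : ℕ → Set ℝ}
    (hC : ∀ k, MeasurableSet (C k)) (hCB : ∀ k, C k ⊆ B)
    (hvol : ∀ k : ℕ, volume (C k) = ENNReal.ofReal k) :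
    ∀ᵐ ω ∂P, ∃ n, X n ω ∈ B := by
  rw [ae_iff]
  -- A set `B` without points forces `C k` to be empty of points, which has Poisson probability `exp
  -- (-k)`.
  have hle : ∀ k : ℕ, P {ω | ¬ ∃ n, X n ω ∈ B} ≤ ENNReal.ofReal (Real.exp (-k)) := by
    intro k
    have hlt : volume (C k) < ∞ := by rw [hvol]; exact ENNReal.ofReal_lt_top
    have h1 := h.measure_pointCount_eq (hC k) hlt 0
    rw [poissonMeasure_singleton, hvol] at h1
    have e : ((ENNReal.ofReal (k : ℝ)).toNNReal : ℝ) = k := by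
      rw [ENNReal.coe_toNNReal_eq_toReal, ENNReal.toReal_ofReal (by positivity)]
    rw [e] at h1
    simp only [pow_zero, mul_one, Nat.factorial_zero, Nat.cast_one, div_one] at h1
    rw [← h1]
    refine measure_mono fun ω hω => ?_
    change pointCount (C k) (fun n => X n ω) = ((0 : ℕ) : ℝ≥0∞)
    rw [Nat.cast_zero]
    refine ENNReal.tsum_eq_zero.mpr fun n => ?_
    rw [indicator_of_notMem]
    exact fun hn => hω ⟨n, hCB k hn⟩
  have hlim : Filter.Tendsto (fun k : ℕ => ENNReal.ofReal (Real.exp (-(k : ℝ)))) Filter.atTop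
      (nhds 0) := by
    rw [← ENNReal.ofReal_zero]
    exact ENNReal.tendsto_ofReal
      (Real.tendsto_exp_neg_atTop_nhds_zero.comp tendsto_natCast_atTop_atTop)
  exact le_antisymm (ge_of_tendsto' hlim hle) bot_le

/-- Infinitely many marks include a large one. -/
lemma IsMarkedPoisson.ae_exists_le_mark (h : IsMarkedPoisson P F X D) {i : ℕ}
    (hi : F.toMeasure (Ici i) ≠ 0) {A : Set ℕ} (hA : A.Infinite) :
    ∀ᵐ ω ∂P, ∃ n ∈ A, i ≤ D n ω := by
  rw [ae_iff]
  have hq : F.toMeasure (Iio i) < 1 := by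
    have h1 := prob_add_prob_compl (μ := F.toMeasure) (measurableSet_Iio (a := i))
    rw [compl_Iio] at h1
    refine lt_of_le_of_ne prob_le_one fun e => hi ?_
    rw [e] at h1
    exact (ENNReal.add_right_inj ENNReal.one_ne_top).mp (h1.trans (add_zero 1).symm)
  -- By independence, `k` indices of `A` all have small marks with probability the `k`-th power of a
  -- number below `1`.
  have hle : ∀ k : ℕ, P {ω | ¬ ∃ n ∈ A, i ≤ D n ω} ≤ F.toMeasure (Iio i) ^ k := by
    intro k
    obtain ⟨s, hs, hk⟩ := hA.exists_subset_card_eq k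
    have h1 := h.mark_indep.measure_inter_preimage_eq_mul s (sets := fun _ => Iio i)
      (fun _ _ => measurableSet_Iio)
    have h2 : ∀ n, P (D n ⁻¹' Iio i) = F.toMeasure (Iio i) := fun n => by
      rw [← h.mark_law n, Measure.map_apply (h.measurable_mark n) measurableSet_Iio]
    simp only [h2, Finset.prod_const, hk] at h1
    rw [← h1]
    refine measure_mono fun ω hω => ?_
    simp only [mem_iInter]
    intro n hn
    by_contra hlt
    exact hω ⟨n, hs hn, not_lt.mp hlt⟩
  exact le_antisymm (ge_of_tendsto' (ENNReal.tendsto_pow_atTop_nhds_zero_of_lt_one hq) hle) bot_le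

/-- Points of degree at least `i` do not occur if `F` does not charge `[i, ∞)`. -/
lemma IsMarkedPoisson.ae_mark_lt (h : IsMarkedPoisson P F X D) {i : ℕ}
    (hi : F.toMeasure (Ici i) = 0) : ∀ᵐ ω ∂P, ∀ n, D n ω < i := by
  refine ae_all_iff.mpr fun n => ?_
  rw [ae_iff]
  simp only [not_lt]
  rw [h.measure_le_mark, hi]

lemma IsPoissonProcess.ae_unbounded (h : IsPoissonProcess P X) :
    ∀ᵐ ω ∂P, ∀ a : ℝ, (∃ n, X n ω ∈ Ioi a) ∧ ∃ n, X n ω ∈ Iio a := by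
  have h1 : ∀ᵐ ω ∂P, ∀ k : ℕ, ∃ n, X n ω ∈ Ioi (k : ℝ) := ae_all_iff.mpr fun k =>
    h.ae_exists_mem (C := fun l => Ioc (k : ℝ) (k + l)) (fun _ => measurableSet_Ioc)
      (fun l a ha => ha.1) (fun l => by simp)
  have h2 : ∀ᵐ ω ∂P, ∀ k : ℕ, ∃ n, X n ω ∈ Iio (-k : ℝ) := ae_all_iff.mpr fun k =>
    h.ae_exists_mem (C := fun l => Ico (-k - l : ℝ) (-k)) (fun _ => measurableSet_Ico)
      (fun l a ha => ha.2) (fun l => by simp)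
  filter_upwards [h1, h2] with ω h1 h2 a
  obtain ⟨k, hk⟩ := exists_nat_ge |a|
  obtain ⟨n, hn⟩ := h1 k
  obtain ⟨m, hm⟩ := h2 k
  have hm' : X m ω < -k := hm
  refine ⟨⟨n, lt_of_le_of_lt ((le_abs_self a).trans hk) hn⟩, m, ?_⟩
  have : X m ω < a := by linarith [neg_abs_le a]
  exact this

variable [IsProbabilityMeasure P]

/-- The disjoint events that the count equals `k` have the Poisson weights as probabilities, and
these sum to `1`. -/
lemma IsPoissonProcess.ae_pointCount_eq (h : IsPoissonProcess P X) {B : Set ℝ}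
    (hB : MeasurableSet B) (hB' : volume B < ∞) :
    ∀ᵐ ω ∂P, ∃ k : ℕ, pointCount B (fun n => X n ω) = k := by
  have hm := h.measurable_pointCount hB
  have hmeas : ∀ k : ℕ, MeasurableSet {ω | pointCount B (fun n => X n ω) = k} := fun k =>
    hm (measurableSet_singleton (k : ℝ≥0∞))
  have h1 : P (⋃ k : ℕ, {ω | pointCount B (fun n => X n ω) = k}) = 1 := by
    rw [measure_iUnion _ hmeas]
    · simp_rw [h.measure_pointCount_eq hB hB']
      have := (lintegral_countable' (μ := poissonMeasure (volume B).toNNReal)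
        (fun _ : ℕ => (1 : ℝ≥0∞)))
      simp only [one_mul, lintegral_one, measure_univ] at this
      exact this.symm
    · intro j k hjk
      refine disjoint_left.mpr fun ω hj hk => hjk ?_
      exact_mod_cast (Eq.symm hj).trans hk
  have h2 := (prob_compl_eq_zero_iff (MeasurableSet.iUnion hmeas)).mpr h1
  rw [ae_iff]
  convert h2 using 2
  ext ω
  simp

/-- The floor only turns the extended count into a natural number; an infinite count, sent to `0`,
is a null event. -/
lemma IsPoissonProcess.map_floor (h : IsPoissonProcess P X) {B : Set ℝ}
    (hB : MeasurableSet B) (hB' : volume B < ∞) :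
    P.map (fun ω => ⌊(pointCount B (fun n => X n ω)).toReal⌋₊) =
      poissonMeasure (volume B).toNNReal := by
  have hm := h.measurable_pointCount hB
  rw [Measure.ext_iff_singleton]
  intro k
  rw [Measure.map_apply hm.ennreal_toReal.nat_floor (measurableSet_singleton k),
    ← h.measure_pointCount_eq hB hB']
  apply measure_congr
  filter_upwards [h.ae_pointCount_eq hB hB'] with ω ⟨j, hj⟩
  apply propext
  change ⌊(pointCount B (fun n => X n ω)).toReal⌋₊ = k ↔ pointCount B (fun n => X n ω) = k
  rw [hj]
  simp

lemma IsPoissonProcess.lintegral_floor (h : IsPoissonProcess P X) {B : Set ℝ}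
    (hB : MeasurableSet B) (hB' : volume B < ∞) (g : ℕ → ℝ≥0∞) :
    ∫⁻ ω, g ⌊(pointCount B (fun n => X n ω)).toReal⌋₊ ∂P =
      ∫⁻ k, g k ∂poissonMeasure (volume B).toNNReal := by
  have hm := h.measurable_pointCount hB
  rw [← h.map_floor hB hB', lintegral_map measurable_from_top
    hm.ennreal_toReal.nat_floor]

lemma IsPoissonProcess.lintegral_pointCount (h : IsPoissonProcess P X) {B : Set ℝ}
    (hB : MeasurableSet B) (hB' : volume B < ∞) :
    ∫⁻ ω, pointCount B (fun n => X n ω) ∂P = volume B := by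
  have h1 := h.lintegral_floor hB hB' (fun k => (k : ℝ≥0∞))
  rw [lintegral_poissonMeasure_cast, ENNReal.coe_toNNReal hB'.ne] at h1
  rw [← h1]
  apply lintegral_congr_ae
  filter_upwards [h.ae_pointCount_eq hB hB'] with ω ⟨j, hj⟩
  rw [hj]
  simp

lemma IsPoissonProcess.ae_finite (h : IsPoissonProcess P X) :
    ∀ᵐ ω ∂P, ∀ a b, {n | X n ω ∈ Icc a b}.Finite := by
  have h1 : ∀ᵐ ω ∂P, ∀ N : ℕ, ∃ k : ℕ, pointCount (Icc (-N : ℝ) N) (fun n => X n ω) = k :=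
    ae_all_iff.mpr fun N => h.ae_pointCount_eq measurableSet_Icc (by simp)
  filter_upwards [h1] with ω hω a b
  obtain ⟨N, hN⟩ := exists_nat_ge (max |a| |b|)
  obtain ⟨k, hk⟩ := hω N
  rw [pointCount_eq_encard, ← ENat.toENNReal_coe, ENat.toENNReal_inj] at hk
  refine (finite_of_encard_eq_coe hk).subset fun n hn => ⟨?_, ?_⟩
  · have := neg_abs_le a
    have := (le_max_left _ _).trans hN
    linarith [hn.1]
  · have := le_abs_self b
    have := (le_max_right _ _).trans hN
    linarith [hn.2]

/-- The mean count of `{0}` is its volume `0`. The coin refers to the origin, so the origin must not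
be a point. -/
lemma IsPoissonProcess.ae_ne_zero (h : IsPoissonProcess P X) :
    ∀ᵐ ω ∂P, ∀ n, X n ω ≠ 0 := by
  have h1 := h.lintegral_pointCount (measurableSet_singleton (0 : ℝ)) (by simp)
  rw [Real.volume_singleton, lintegral_eq_zero_iff (h.measurable_pointCount
    (measurableSet_singleton _))] at h1
  filter_upwards [h1] with ω hω n hn
  have := ENNReal.tsum_eq_zero.mp hω n
  simp [hn] at this

/-- Points and marks can be sampled separately. -/
lemma IsMarkedPoisson.lintegral_eq (h : IsMarkedPoisson P F X D)
    {g : (ℕ → ℝ) × (ℕ → ℕ) → ℝ≥0∞} (hg : Measurable g) :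
    ∫⁻ ω, g ((fun n => X n ω), (fun n => D n ω)) ∂P =
      ∫⁻ ω, ∫⁻ ω', g ((fun n => X n ω), (fun n => D n ω')) ∂P ∂P := by
  have hX := h.ground.measurable_pi
  have hD := h.measurable_marks
  have h1 := (indepFun_iff_map_prod_eq_prod_map_map hX.aemeasurable hD.aemeasurable).mp
    h.mark_indep_ground
  have : IsProbabilityMeasure (P.map fun ω n => D n ω) :=
    Measure.isProbabilityMeasure_map hD.aemeasurable
  rw [← lintegral_map (f := g) hg h.measurable_pair, h1, lintegral_prod _ hg.aemeasurable,
    lintegral_map hg.lintegral_prod_right' hX]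
  refine lintegral_congr fun ω => ?_
  exact lintegral_map (hg.comp measurable_prodMk_left) hD

lemma IsMarkedPoisson.ae_of_ae_ae (h : IsMarkedPoisson P F X D)
    {s : Set ((ℕ → ℝ) × (ℕ → ℕ))} (hs : MeasurableSet s)
    (hs' : ∀ᵐ ω ∂P, ∀ᵐ ω' ∂P, ((fun n => X n ω), (fun n => D n ω')) ∈ s) :
    ∀ᵐ ω ∂P, ((fun n => X n ω), (fun n => D n ω)) ∈ s := by
  have hm : Measurable (sᶜ.indicator (1 : (ℕ → ℝ) × (ℕ → ℕ) → ℝ≥0∞)) :=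
    measurable_one.indicator hs.compl
  have h1 := h.lintegral_eq hm
  have h2 : ∫⁻ ω, ∫⁻ ω', sᶜ.indicator (1 : (ℕ → ℝ) × (ℕ → ℕ) → ℝ≥0∞)
      ((fun n => X n ω), (fun n => D n ω')) ∂P ∂P = 0 := by
    rw [← lintegral_zero (μ := P)]
    refine lintegral_congr_ae ?_
    filter_upwards [hs'] with ω hω
    rw [← lintegral_zero (μ := P)]
    refine lintegral_congr_ae ?_
    filter_upwards [hω] with ω' hω'
    simp [hω']
  rw [h2] at h1
  replace h1 := (lintegral_eq_zero_iff (hm.comp h.measurable_pair)).mp h1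
  filter_upwards [h1] with ω hω
  by_contra hn
  simp [hn] at hω

/-- The law of the number of large marks in a finite index set depends only on its size. -/
lemma IsMarkedPoisson.lintegral_marks (h : IsMarkedPoisson P F X D) (i : ℕ) {f : ℝ≥0∞ → ℝ≥0∞}
    (hf : Measurable f) {A : Set ℕ} (hA : A.Finite) :
    ∫⁻ ω, f {n | n ∈ A ∧ i ≤ D n ω}.encard ∂P =
      ∫⁻ y : Fin A.ncard → ℕ, f (∑ j, (Ici i).indicator 1 (y j))
        ∂Measure.pi fun _ => F.toMeasure := by
  obtain ⟨s, rfl⟩ := hA.exists_finset_coe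
  rw [ncard_coe_finset]
  set e := s.orderEmbOfFin rfl
  have h1 := h.mark_indep.precomp e.injective
  rw [iIndepFun_iff_map_fun_eq_pi_map fun j => (h.measurable_mark _).aemeasurable] at h1
  simp_rw [h.mark_law] at h1
  rw [← h1, lintegral_map (by fun_prop)
    (measurable_pi_lambda _ fun j => h.measurable_mark _)]
  refine lintegral_congr fun ω => ?_
  congr 1
  have h2 : {n | n ∈ (s : Set ℕ) ∧ i ≤ D n ω} = e '' {j | i ≤ D (e j) ω} := by
    ext n
    constructor
    · rintro ⟨hn, hi⟩
      rw [← s.range_orderEmbOfFin rfl] at hn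
      obtain ⟨j, rfl⟩ := hn
      exact ⟨j, hi, rfl⟩
    · rintro ⟨j, hj, rfl⟩
      exact ⟨s.orderEmbOfFin_mem rfl j, hj⟩
  rw [h2, e.injective.injOn.encard_image, ← ENNReal.tsum_set_one,
    tsum_subtype {j | i ≤ D (e j) ω} (fun _ => (1 : ℝ≥0∞)), tsum_fintype]
  rfl

/-- Stationarity: the law of the number of points of degree at least `i` in a set depends only on
the volume of the set. -/
lemma IsMarkedPoisson.lintegral_stubCount_congr (h : IsMarkedPoisson P F X D) (i : ℕ)
    {f : ℝ≥0∞ → ℝ≥0∞} (hf : Measurable f) {B B' : Set ℝ} (hB : MeasurableSet B)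
    (hB' : MeasurableSet B') (hlt : volume B < ∞) (hvol : volume B = volume B') :
    ∫⁻ ω, f (stubCount i B ((fun n => X n ω), (fun n => D n ω))) ∂P =
      ∫⁻ ω, f (stubCount i B' ((fun n => X n ω), (fun n => D n ω))) ∂P := by
  -- Fixing the positions, the law of the number of large marks depends only on the number of points
  -- in `C`, which is Poisson with mean the volume of `C`.
  have key : ∀ C : Set ℝ, MeasurableSet C → volume C < ∞ →
      ∫⁻ ω, f (stubCount i C ((fun n => X n ω), (fun n => D n ω))) ∂P =
        ∫⁻ k, (∫⁻ y : Fin k → ℕ, f (∑ j, (Ici i).indicator 1 (y j))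
          ∂Measure.pi fun _ => F.toMeasure) ∂poissonMeasure (volume C).toNNReal := by
    intro C hC hClt
    rw [h.lintegral_eq (g := fun z => f (stubCount i C z))
      (hf.comp (measurable_stubCount i hC)), ← h.ground.lintegral_floor hC hClt]
    refine lintegral_congr_ae ?_
    filter_upwards [h.ground.ae_pointCount_eq hC hClt] with ω ⟨k, hk⟩
    rw [hk]
    rw [pointCount_eq_encard, ← ENat.toENNReal_coe, ENat.toENNReal_inj] at hk
    have hk' : {n | X n ω ∈ C}.ncard = k := by rw [ncard, hk]; rfl
    have e : ⌊(k : ℝ≥0∞).toReal⌋₊ = k := by simp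
    rw [e, ← hk', ← h.lintegral_marks i hf (finite_of_encard_eq_coe hk)]
    refine lintegral_congr fun ω' => ?_
    rw [stubCount_eq_encard]
    rfl
  rw [key B hB hlt, key B' hB' (hvol ▸ hlt), hvol]

lemma IsMarkedPoisson.lintegral_stubCount (h : IsMarkedPoisson P F X D) (i : ℕ)
    {B : Set ℝ} (hB : MeasurableSet B) (hlt : volume B < ∞) :
    ∫⁻ ω, stubCount i B ((fun n => X n ω), (fun n => D n ω)) ∂P =
      F.toMeasure (Ici i) * volume B := by
  rw [h.lintegral_eq (measurable_stubCount i hB), ← h.ground.lintegral_pointCount hB hlt,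
    ← lintegral_const_mul _ (h.ground.measurable_pointCount hB)]
  refine lintegral_congr fun ω => ?_
  have hm : ∀ n, Measurable fun ω' => (Ici i).indicator (1 : ℕ → ℝ≥0∞) (D n ω') := fun n =>
    (measurable_one.indicator measurableSet_Ici).comp (h.measurable_mark n)
  simp only [stubCount, pointCount]
  rw [lintegral_tsum fun n => ((hm n).const_mul _).aemeasurable, ← ENNReal.tsum_mul_left]
  refine tsum_congr fun n => ?_
  rw [lintegral_const_mul _ (hm n), mul_comm]
  congr 1
  rw [← h.measure_le_mark i n, ← lintegral_indicator_one
    (measurableSet_le measurable_const (h.measurable_mark n))]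
  rfl

/-- The points of degree at least `i` are unbounded in both directions. -/
lemma IsMarkedPoisson.ae_unbounded (h : IsMarkedPoisson P F X D) {i : ℕ}
    (hi : F.toMeasure (Ici i) ≠ 0) :
    ∀ᵐ ω ∂P, ∀ a : ℝ, (∃ n, a < X n ω ∧ i ≤ D n ω) ∧ ∃ n, X n ω < a ∧ i ≤ D n ω := by
  -- Marks are independent of positions, so infinitely many points in `B` almost surely include one
  -- with a large mark.
  have key : ∀ B : Set ℝ, MeasurableSet B → (∀ᵐ ω ∂P, {n | X n ω ∈ B}.Infinite) →
      ∀ᵐ ω ∂P, ∃ n, X n ω ∈ B ∧ i ≤ D n ω := by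
    intro B hB hinf
    refine h.ae_of_ae_ae (s := {z | ∃ n, z.1 n ∈ B ∧ i ≤ z.2 n}) ?_ ?_
    · have e : {z : (ℕ → ℝ) × (ℕ → ℕ) | ∃ n, z.1 n ∈ B ∧ i ≤ z.2 n} =
          ⋃ n, {z | z.1 n ∈ B ∧ i ≤ z.2 n} := by
        ext z
        simp
      rw [e]
      refine MeasurableSet.iUnion fun n => MeasurableSet.inter ?_ ?_
      · exact ((measurable_pi_apply n).comp measurable_fst) hB
      · exact ((measurable_pi_apply n).comp measurable_snd) measurableSet_Ici
    · filter_upwards [hinf] with ω hω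
      exact h.ae_exists_le_mark hi hω
  have habove : ∀ᵐ ω ∂P, ∀ k : ℕ, ∃ n, X n ω ∈ Ioi (k : ℝ) ∧ i ≤ D n ω := by
    refine ae_all_iff.mpr fun k => key _ measurableSet_Ioi ?_
    filter_upwards [h.ground.ae_unbounded] with ω hω hfin
    obtain ⟨b, hb⟩ := (hfin.image fun n => X n ω).bddAbove
    obtain ⟨n, hn⟩ := (hω (max b k)).1
    have hn' := max_lt_iff.mp (mem_Ioi.mp hn)
    exact (hb ⟨n, hn'.2, rfl⟩).not_gt hn'.1
  have hbelow : ∀ᵐ ω ∂P, ∀ k : ℕ, ∃ n, X n ω ∈ Iio (-k : ℝ) ∧ i ≤ D n ω := by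
    refine ae_all_iff.mpr fun k => key _ measurableSet_Iio ?_
    filter_upwards [h.ground.ae_unbounded] with ω hω hfin
    obtain ⟨b, hb⟩ := (hfin.image fun n => X n ω).bddBelow
    obtain ⟨n, hn⟩ := (hω (min b (-k))).2
    have hn' := lt_min_iff.mp (mem_Iio.mp hn)
    exact (hb ⟨n, hn'.2, rfl⟩).not_gt hn'.1
  filter_upwards [habove, hbelow] with ω h1 h2 a
  obtain ⟨k, hk⟩ := exists_nat_ge |a|
  obtain ⟨n, hn, hni⟩ := h1 k
  obtain ⟨m, hm, hmi⟩ := h2 k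
  refine ⟨⟨n, lt_of_le_of_lt ((le_abs_self a).trans hk) hn, hni⟩, m, lt_of_lt_of_le hm ?_, hmi⟩
  linarith [neg_abs_le a]

end PoissonPoints

/-! ### Mass transport -/

/-- The elements counted are the top `m` of `U`. The induction adds a new minimum `a`, which leaves
the upper counts of the others unchanged and has all of `U` above it. -/
lemma card_filter_card_le {ι α : Type*} [DecidableEq ι] [LinearOrder α] {f : ι → α}
    (hf : Function.Injective f) (U : Finset ι) (m : ℕ) :
    (U.filter fun n => (U.filter fun k => f n ≤ f k).card ≤ m).card = min U.card m := by
  induction U using Finset.induction_on_min_value f with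
  | empty => simp
  | insert a s ha hmin ih =>
    have h1 : ∀ n ∈ s, ((insert a s).filter fun k => f n ≤ f k) = s.filter fun k => f n ≤ f k := by
      intro n hn
      rw [Finset.filter_insert, if_neg]
      refine not_le.mpr (lt_of_le_of_ne (hmin n hn) fun e => ha ?_)
      rwa [hf e]
    have h2 : ((insert a s).filter fun k => f a ≤ f k) = insert a s := by
      refine Finset.filter_true_of_mem fun k hk => ?_
      rcases Finset.mem_insert.mp hk with rfl | hk
      · exact le_rfl
      · exact hmin k hk
    rw [Finset.filter_insert, h2, Finset.card_insert_of_notMem ha, Finset.filter_congr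
      fun n hn => by rw [h1 n hn]]
    split_ifs with h
    · rw [Finset.card_insert_of_notMem (fun hh => ha (Finset.mem_filter.mp hh).1), ih]
      omega
    · rw [ih]
      omega

/-- Among the points of `U` with at most `m` points of `U` above them, those that are not in a
given upper part of `U`. -/
lemma card_filter_card_le_add {ι α : Type*} [DecidableEq ι] [LinearOrder α] {f : ι → α}
    (hf : Function.Injective f) (U : Finset ι) (m : ℕ) (p : ι → Prop) [DecidablePred p]
    (hp : ∀ n k, p n → f n ≤ f k → p k) :
    (U.filter fun n => ¬ p n ∧ (U.filter fun k => f n ≤ f k).card ≤ m).card +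
      min (U.filter p).card m = min U.card m := by
  rw [← card_filter_card_le hf (U.filter p), ← card_filter_card_le hf U,
    ← Finset.card_filter_add_card_filter_not
      (s := U.filter fun n => (U.filter fun k => f n ≤ f k).card ≤ m) p, add_comm]
  have h1 : (U.filter fun n => ¬ p n ∧ (U.filter fun k => f n ≤ f k).card ≤ m) =
      (U.filter fun n => (U.filter fun k => f n ≤ f k).card ≤ m).filter fun n => ¬ p n := by
    rw [Finset.filter_filter]
    exact Finset.filter_congr fun n _ => and_comm
  -- As `p` is closed upwards, an element satisfying `p` has the same elements above it in `U` as in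
  -- the part of `U` satisfying `p`.
  have h2 : ((U.filter p).filter fun n => ((U.filter p).filter fun k => f n ≤ f k).card ≤ m) =
      (U.filter fun n => (U.filter fun k => f n ≤ f k).card ≤ m).filter p := by
    rw [Finset.filter_comm, Finset.filter_filter, Finset.filter_filter]
    refine Finset.filter_congr fun n _ => ?_
    refine and_congr_left fun hpn => ?_
    rw [Finset.filter_filter]
    have : (U.filter fun k => p k ∧ f n ≤ f k) = U.filter fun k => f n ≤ f k :=
      Finset.filter_congr fun k _ => ⟨fun h => h.2, fun h => ⟨hp n k hpn h, h⟩⟩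
    rw [this]
  rw [h1, h2]

/-- A telescoping integral. -/
lemma lintegral_eq_of_add_shift_eq {H φ : ℝ → ℝ≥0∞} {m : ℕ} (hφ : Monotone φ)
    (h0 : ∀ s < 0, φ s = 0) (hle : ∀ s, φ s ≤ m)
    (hlim : Filter.Tendsto (fun k : ℕ => φ k) Filter.atTop (nhds m))
    (hH : ∀ t, H t + φ (t - 1) = φ t) : ∫⁻ t, H t = m := by
  have hfin : ∀ s, φ s ≠ ∞ := fun s => ((hle s).trans_lt (ENNReal.natCast_lt_top m)).ne
  have hφm : Measurable φ := hφ.measurable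
  have hφm' : Measurable fun t => φ (t - 1) := hφm.comp (measurable_id.sub_const 1)
  have hHm : Measurable H := by
    have : H = fun t => φ t - φ (t - 1) := by
      ext t
      rw [← hH t, ENNReal.add_sub_cancel_right (hfin _)]
    rw [this]
    exact hφm.sub hφm'
  -- Up to `N + 1`, the shifted integral of `φ` cancels that of `φ` except on the last unit
  -- interval. There `φ` lies between `φ N` and `m`, which gives the limit.
  have hb : ∀ N : ℕ, ∫⁻ t in Iio ((N : ℝ) + 1), H t = ∫⁻ t in Ico (N : ℝ) (N + 1), φ t := by
    intro N
    have h1 : ∫⁻ t in Iio ((N : ℝ) + 1), H t + φ (t - 1) = ∫⁻ t in Iio ((N : ℝ) + 1), φ t :=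
      lintegral_congr fun t => hH t
    have h2 : ∫⁻ t in Iio ((N : ℝ) + 1), φ (t - 1) = ∫⁻ t in Iio (N : ℝ), φ t := by
      rw [← lintegral_indicator measurableSet_Iio, ← lintegral_indicator measurableSet_Iio,
        ← lintegral_sub_right_eq_self ((Iio (N : ℝ)).indicator φ) (1 : ℝ)]
      refine lintegral_congr fun t => ?_
      simp only [indicator, mem_Iio, sub_lt_iff_lt_add]
    have h3 : Iio ((N : ℝ) + 1) = Iio (N : ℝ) ∪ Ico (N : ℝ) (N + 1) :=
      (Iio_union_Ico_eq_Iio (by linarith)).symm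
    have h4 : ∫⁻ t in Iio ((N : ℝ) + 1), φ t =
        (∫⁻ t in Ico (N : ℝ) (N + 1), φ t) + ∫⁻ t in Iio (N : ℝ), φ t := by
      rw [h3, lintegral_union measurableSet_Ico, add_comm]
      exact disjoint_left.mpr fun a ha hb => (mem_Iio.mp ha).not_ge hb.1
    -- Finiteness permits the cancellation: `φ` vanishes on the negative half-line and is at most
    -- `m`.
    have h5 : ∫⁻ t in Iio (N : ℝ), φ t ≠ ∞ := by
      refine ne_top_of_le_ne_top (b := ∫⁻ t, (Ico (0 : ℝ) N).indicator (fun _ => (m : ℝ≥0∞)) t) ?_ ?_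
      · rw [lintegral_indicator_const measurableSet_Ico, Real.volume_Ico]
        exact ENNReal.mul_ne_top (ENNReal.natCast_ne_top m) ENNReal.ofReal_ne_top
      · rw [← lintegral_indicator measurableSet_Iio]
        refine lintegral_mono fun t => ?_
        by_cases h : t < N
        · by_cases h' : t < 0
          · simp [indicator, h0 t h']
          · simp [indicator, h, not_lt.mp h', hle t]
        · simp [indicator, h]
    rw [lintegral_add_right _ hφm', h2, h4] at h1
    exact (ENNReal.add_left_inj h5).mp h1
  have hvol : ∀ (N : ℕ) (c : ℝ≥0∞), ∫⁻ _ in Ico (N : ℝ) (N + 1), c = c := by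
    intro N c
    rw [setLIntegral_const, Real.volume_Ico]
    simp
  have hlim2 : Filter.Tendsto (fun N : ℕ => ∫⁻ t in Iio ((N : ℝ) + 1), H t) Filter.atTop
      (nhds m) := by
    simp_rw [hb]
    refine tendsto_of_tendsto_of_tendsto_of_le_of_le hlim tendsto_const_nhds ?_ ?_
    · intro N
      change φ N ≤ _
      rw [← hvol N (φ N)]
      exact setLIntegral_mono hφm fun t ht => hφ ht.1
    · intro N
      change _ ≤ (m : ℝ≥0∞)
      rw [← hvol N m]
      exact lintegral_mono fun t => hle t
  have hlim3 := (aecover_Iio (μ := volume) (l := Filter.atTop)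
    (b := fun N : ℕ => (N : ℝ) + 1)
    (Filter.tendsto_atTop_add_const_right _ _ tendsto_natCast_atTop_atTop)
    ).lintegral_tendsto_of_countably_generated hHm.aemeasurable
  exact tendsto_nhds_unique hlim3 hlim2

/-- The indicator that the `n`-th point lies in `[0, 1)` and has at least `i` stubs. -/
def unitWeight (i n : ℕ) (z : (ℕ → ℝ) × (ℕ → ℕ)) : ℝ≥0∞ :=
  (Ico 0 1).indicator 1 (z.1 n) * (Ici i).indicator 1 (z.2 n)

/-- Triples `(z, x, t)` such that `[x, t]` has at most `m` points of degree at least `i`. -/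
def reachRight (i m : ℕ) : Set (((ℕ → ℝ) × (ℕ → ℕ)) × ℝ × ℝ) :=
  {q | q.2.1 ≤ q.2.2 ∧ stubCount i (Icc q.2.1 q.2.2) q.1 ≤ m}

/-- Triples `(z, x, t)` such that `[t, x]` has at most `m` points of degree at least `i`. -/
def reachLeft (i m : ℕ) : Set (((ℕ → ℝ) × (ℕ → ℕ)) × ℝ × ℝ) :=
  {q | q.2.2 ≤ q.2.1 ∧ stubCount i (Icc q.2.2 q.2.1) q.1 ≤ m}

/-- The length of the set of `t` with `(z, x, t) ∈ R`. -/
def reachLength (R : Set (((ℕ → ℝ) × (ℕ → ℕ)) × ℝ × ℝ)) (z : (ℕ → ℝ) × (ℕ → ℕ)) (x : ℝ) :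
    ℝ≥0∞ := volume {t | (z, x, t) ∈ R}

lemma measurable_unitWeight (i n : ℕ) : Measurable (unitWeight i n) := by
  refine Measurable.mul ?_ ?_
  · exact (measurable_one.indicator measurableSet_Ico).comp
      ((measurable_pi_apply n).comp measurable_fst)
  · exact (measurable_one.indicator measurableSet_Ici).comp
      ((measurable_pi_apply n).comp measurable_snd)

lemma measurable_stubCount_Icc (i : ℕ) {α : Type*} [MeasurableSpace α]
    {z : α → (ℕ → ℝ) × (ℕ → ℕ)} {a b : α → ℝ} (hz : Measurable z) (ha : Measurable a)
    (hb : Measurable b) : Measurable fun q => stubCount i (Icc (a q) (b q)) (z q) := by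
  unfold stubCount
  refine Measurable.tsum fun n => Measurable.mul ?_ ?_
  · have hn : Measurable fun q => (z q).1 n := (measurable_pi_apply n).comp (measurable_fst.comp hz)
    exact measurable_one.indicator ((measurableSet_le ha hn).inter (measurableSet_le hn hb))
  · exact (measurable_one.indicator measurableSet_Ici).comp
      ((measurable_pi_apply n).comp (measurable_snd.comp hz))

lemma measurableSet_reachRight (i m : ℕ) : MeasurableSet (reachRight i m) := by
  have h1 : Measurable fun q : ((ℕ → ℝ) × (ℕ → ℕ)) × ℝ × ℝ => q.2.1 := by fun_prop
  have h2 : Measurable fun q : ((ℕ → ℝ) × (ℕ → ℕ)) × ℝ × ℝ => q.2.2 := by fun_prop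
  exact (measurableSet_le h1 h2).inter
    (measurableSet_le (measurable_stubCount_Icc i measurable_fst h1 h2) measurable_const)

lemma measurableSet_reachLeft (i m : ℕ) : MeasurableSet (reachLeft i m) := by
  have h1 : Measurable fun q : ((ℕ → ℝ) × (ℕ → ℕ)) × ℝ × ℝ => q.2.1 := by fun_prop
  have h2 : Measurable fun q : ((ℕ → ℝ) × (ℕ → ℕ)) × ℝ × ℝ => q.2.2 := by fun_prop
  exact (measurableSet_le h2 h1).inter
    (measurableSet_le (measurable_stubCount_Icc i measurable_fst h2 h1) measurable_const)

lemma measurable_reachLength {R : Set (((ℕ → ℝ) × (ℕ → ℕ)) × ℝ × ℝ)} (hR : MeasurableSet R)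
    (n : ℕ) : Measurable fun z => reachLength R z (z.1 n) := by
  have h1 : Measurable fun q : ((ℕ → ℝ) × (ℕ → ℕ)) × ℝ => (q.1, q.1.1 n, q.2) := by fun_prop
  exact measurable_measure_prodMk_left (h1 hR)

lemma tsum_unitWeight_mul_indicator (i : ℕ) (R : Set (((ℕ → ℝ) × (ℕ → ℕ)) × ℝ × ℝ))
    (z : (ℕ → ℝ) × (ℕ → ℕ)) (t : ℝ) :
    ∑' n, unitWeight i n z * R.indicator 1 (z, z.1 n, t) =
      ({n | (z.1 n ∈ Ico 0 1 ∧ i ≤ z.2 n) ∧ (z, z.1 n, t) ∈ R}.encard : ℝ≥0∞) := by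
  rw [← ENNReal.tsum_set_one, tsum_subtype _ (fun _ => (1 : ℝ≥0∞))]
  refine tsum_congr fun n => ?_
  by_cases h1 : z.1 n ∈ Ico 0 1 <;> by_cases h2 : i ≤ z.2 n <;>
    by_cases h3 : (z, z.1 n, t) ∈ R <;> simp [unitWeight, indicator, h1, h2, h3, -mem_Ico]

lemma stubCount_eq_card {i : ℕ} {B : Set ℝ} {z : (ℕ → ℝ) × (ℕ → ℕ)} {U : Finset ℕ}
    (hU : ∀ n, n ∈ U ↔ z.1 n ∈ B ∧ i ≤ z.2 n) : stubCount i B z = U.card := by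
  rw [stubCount_eq_encard]
  have : {n | z.1 n ∈ B ∧ i ≤ z.2 n} = U := by
    ext n
    exact (hU n).symm
  rw [this, encard_coe_eq_coe_finsetCard, ENat.toENNReal_coe]

/-- The points that reach `t` are the last `m` in `[0, t]`. Those of them in `[1, t]` number `min
(stubCount i (Icc 1 t) z) m`, and the rest lie in `[0, 1)`. The additive form avoids subtraction in
`ℝ≥0∞`. -/
lemma tsum_reachRight_add (i m : ℕ) {z : (ℕ → ℝ) × (ℕ → ℕ)} (hz : Function.Injective z.1)
    {t : ℝ} (hfin : {n | z.1 n ∈ Icc 0 t}.Finite) :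
    ∑' n, unitWeight i n z * (reachRight i m).indicator 1 (z, z.1 n, t) +
      min (stubCount i (Icc 1 t) z) m = min (stubCount i (Icc 0 t) z) m := by
  have hfin' : {n | z.1 n ∈ Icc 0 t ∧ i ≤ z.2 n}.Finite := hfin.subset fun n hn => hn.1
  set U := hfin'.toFinset with hUdef
  have hU : ∀ n, n ∈ U ↔ z.1 n ∈ Icc 0 t ∧ i ≤ z.2 n := fun n => by simp [hUdef]
  have hV : ∀ n, n ∈ U.filter (fun n => 1 ≤ z.1 n) ↔ z.1 n ∈ Icc 1 t ∧ i ≤ z.2 n := fun n => by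
    rw [Finset.mem_filter, hU]
    simp only [mem_Icc]
    constructor
    · rintro ⟨⟨⟨h1, h2⟩, h3⟩, h4⟩
      exact ⟨⟨h4, h2⟩, h3⟩
    · rintro ⟨⟨h1, h2⟩, h3⟩
      exact ⟨⟨⟨by linarith, h2⟩, h3⟩, h1⟩
  have hQ : ∀ n ∈ U, stubCount i (Icc (z.1 n) t) z =
      (U.filter fun k => z.1 n ≤ z.1 k).card := fun n hn => stubCount_eq_card fun k => by
    rw [Finset.mem_filter, hU]
    have := ((hU n).mp hn).1.1
    simp only [mem_Icc]
    constructor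
    · rintro ⟨⟨⟨h1, h2⟩, h3⟩, h4⟩
      exact ⟨⟨h4, h2⟩, h3⟩
    · rintro ⟨⟨h1, h2⟩, h3⟩
      exact ⟨⟨⟨by linarith, h2⟩, h3⟩, h1⟩
  have hW : {n | (z.1 n ∈ Ico 0 1 ∧ i ≤ z.2 n) ∧ (z, z.1 n, t) ∈ reachRight i m} =
      (U.filter fun n => ¬ 1 ≤ z.1 n ∧ (U.filter fun k => z.1 n ≤ z.1 k).card ≤ m : Finset ℕ) := by
    ext n
    simp only [Finset.coe_filter, mem_ofPred_eq, reachRight, not_le]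
    constructor
    · rintro ⟨⟨h1, h2⟩, h3, h4⟩
      have hn : n ∈ U := (hU n).mpr ⟨⟨h1.1, h3⟩, h2⟩
      rw [hQ n hn] at h4
      exact ⟨hn, h1.2, by exact_mod_cast h4⟩
    · rintro ⟨hn, h1, h4⟩
      have hn' := (hU n).mp hn
      refine ⟨⟨⟨hn'.1.1, h1⟩, hn'.2⟩, hn'.1.2, ?_⟩
      rw [hQ n hn]
      exact_mod_cast h4
  rw [tsum_unitWeight_mul_indicator, hW, stubCount_eq_card hV, stubCount_eq_card hU,
    encard_coe_eq_coe_finsetCard, ENat.toENNReal_coe]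
  have := card_filter_card_le_add hz U m (fun n => 1 ≤ z.1 n) fun n k h1 h2 => h1.trans h2
  have hmin : ∀ a b : ℕ, ((min a b : ℕ) : ℝ≥0∞) = min (a : ℝ≥0∞) b := fun _ _ =>
    Nat.mono_cast.map_min
  rw [← hmin, ← hmin, ← this, Nat.cast_add]

/-- The same count for the first `m` points of `[t, 1)`, obtained in the dual order. The intervals
are half-open to fit `[0, 1)`. -/
lemma tsum_reachLeft_add (i m : ℕ) {z : (ℕ → ℝ) × (ℕ → ℕ)} (hz : Function.Injective z.1)
    {t : ℝ} (hfin : {n | z.1 n ∈ Icc t 1}.Finite) :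
    ∑' n, unitWeight i n z * (reachLeft i m).indicator 1 (z, z.1 n, t) +
      min (stubCount i (Ico t 0) z) m = min (stubCount i (Ico t 1) z) m := by
  have hfin' : {n | z.1 n ∈ Ico t 1 ∧ i ≤ z.2 n}.Finite :=
    hfin.subset fun n hn => Ico_subset_Icc_self hn.1
  set U := hfin'.toFinset with hUdef
  have hU : ∀ n, n ∈ U ↔ z.1 n ∈ Ico t 1 ∧ i ≤ z.2 n := fun n => by simp [hUdef]
  have hV : ∀ n, n ∈ U.filter (fun n => z.1 n < 0) ↔ z.1 n ∈ Ico t 0 ∧ i ≤ z.2 n := fun n => by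
    rw [Finset.mem_filter, hU]
    simp only [mem_Ico]
    constructor
    · rintro ⟨⟨⟨h1, h2⟩, h3⟩, h4⟩
      exact ⟨⟨h1, h4⟩, h3⟩
    · rintro ⟨⟨h1, h2⟩, h3⟩
      exact ⟨⟨⟨h1, by linarith⟩, h3⟩, h2⟩
  have hQ : ∀ n ∈ U, stubCount i (Icc t (z.1 n)) z =
      (U.filter fun k => z.1 k ≤ z.1 n).card := fun n hn => stubCount_eq_card fun k => by
    rw [Finset.mem_filter, hU]
    have := ((hU n).mp hn).1.2
    simp only [mem_Icc, mem_Ico]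
    constructor
    · rintro ⟨⟨⟨h1, h2⟩, h3⟩, h4⟩
      exact ⟨⟨h1, h4⟩, h3⟩
    · rintro ⟨⟨h1, h2⟩, h3⟩
      exact ⟨⟨⟨h1, by linarith⟩, h3⟩, h2⟩
  have hW : {n | (z.1 n ∈ Ico 0 1 ∧ i ≤ z.2 n) ∧ (z, z.1 n, t) ∈ reachLeft i m} =
      (U.filter fun n => ¬ z.1 n < 0 ∧ (U.filter fun k => z.1 k ≤ z.1 n).card ≤ m : Finset ℕ) := by
    ext n
    simp only [Finset.coe_filter, mem_ofPred_eq, reachLeft, not_lt]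
    constructor
    · rintro ⟨⟨h1, h2⟩, h3, h4⟩
      have hn : n ∈ U := (hU n).mpr ⟨⟨h3, h1.2⟩, h2⟩
      rw [hQ n hn] at h4
      exact ⟨hn, h1.1, by exact_mod_cast h4⟩
    · rintro ⟨hn, h1, h4⟩
      have hn' := (hU n).mp hn
      refine ⟨⟨⟨h1, hn'.1.2⟩, hn'.2⟩, hn'.1.1, ?_⟩
      rw [hQ n hn]
      exact_mod_cast h4
  rw [tsum_unitWeight_mul_indicator, hW, stubCount_eq_card hV, stubCount_eq_card hU,
    encard_coe_eq_coe_finsetCard, ENat.toENNReal_coe]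
  have := card_filter_card_le_add (f := fun n => OrderDual.toDual (z.1 n))
    (OrderDual.toDual.injective.comp hz) U m (fun n => z.1 n < 0)
    fun n k h1 h2 => (OrderDual.toDual_le_toDual.mp h2).trans_lt h1
  simp only [OrderDual.toDual_le_toDual] at this
  have hmin : ∀ a b : ℕ, ((min a b : ℕ) : ℝ≥0∞) = min (a : ℝ≥0∞) b := fun _ _ =>
    Nat.mono_cast.map_min
  rw [← hmin, ← hmin, ← this, Nat.cast_add]

section PoissonPoints

variable {Ω : Type*} [MeasurableSpace Ω] {P : Measure Ω}
  {X : ℕ → Ω → ℝ} {D : ℕ → Ω → ℕ} {F : PMF ℕ}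

/-- The mean number of points of degree at least `i` in `[0, s]`, counted up to `m`. -/
def cappedMean (P : Measure Ω) (X : ℕ → Ω → ℝ) (D : ℕ → Ω → ℕ) (i m : ℕ) (s : ℝ) : ℝ≥0∞ :=
  ∫⁻ ω, min (stubCount i (Icc 0 s) ((fun n => X n ω), (fun n => D n ω))) m ∂P

lemma cappedMean_mono (i m : ℕ) : Monotone (cappedMean P X D i m) := fun _ _ hst =>
  lintegral_mono fun _ => min_le_min_right _ (stubCount_mono i (Icc_subset_Icc_right hst) _)

lemma cappedMean_of_neg (i m : ℕ) {s : ℝ} (hs : s < 0) : cappedMean P X D i m s = 0 := by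
  simp [cappedMean, Icc_eq_empty (not_le.mpr hs), stubCount]

lemma IsMarkedPoisson.measurable_min_stubCount (h : IsMarkedPoisson P F X D) (i m : ℕ)
    {B : Set ℝ} (hB : MeasurableSet B) :
    Measurable fun ω => min (stubCount i B ((fun n => X n ω), (fun n => D n ω))) (m : ℝ≥0∞) :=
  ((measurable_stubCount i hB).comp h.measurable_pair).min measurable_const

variable [IsProbabilityMeasure P]

/-- Tonelli: the length of a reach is the integral over `t` of its indicator. -/
lemma IsMarkedPoisson.lintegral_tsum_reachLength (h : IsMarkedPoisson P F X D) (i : ℕ)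
    {R : Set (((ℕ → ℝ) × (ℕ → ℕ)) × ℝ × ℝ)} (hR : MeasurableSet R) :
    ∫⁻ ω, ∑' n, unitWeight i n ((fun n => X n ω), (fun n => D n ω)) *
        reachLength R ((fun n => X n ω), (fun n => D n ω)) (X n ω) ∂P =
      ∫⁻ t, ∫⁻ ω, ∑' n, unitWeight i n ((fun n => X n ω), (fun n => D n ω)) *
        R.indicator 1 (((fun n => X n ω), (fun n => D n ω)), X n ω, t) ∂P := by
  set z : Ω → (ℕ → ℝ) × (ℕ → ℕ) := fun ω => ((fun n => X n ω), (fun n => D n ω)) with hz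
  have hzm : Measurable z := h.measurable_pair
  have hmeas : ∀ n, Measurable fun q : Ω × ℝ =>
      unitWeight i n (z q.1) * R.indicator (fun _ => (1 : ℝ≥0∞)) (z q.1, X n q.1, q.2) := by
    intro n
    refine ((measurable_unitWeight i n).comp (hzm.comp measurable_fst)).mul ?_
    refine (measurable_const.indicator hR).comp ?_
    exact (hzm.comp measurable_fst).prodMk
      (((h.ground.measurable n).comp measurable_fst).prodMk measurable_snd)
  have hmeas' : ∀ ω n, Measurable fun t => R.indicator (fun _ => (1 : ℝ≥0∞)) (z ω, X n ω, t) :=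
    fun ω n => (measurable_const.indicator hR).comp
      (measurable_const.prodMk (measurable_const.prodMk measurable_id))
  refine Eq.trans ?_ (lintegral_lintegral_swap (μ := P) (ν := volume)
    (f := fun ω t => ∑' n, unitWeight i n (z ω) *
      R.indicator (fun _ => (1 : ℝ≥0∞)) (z ω, X n ω, t))
    (Measurable.tsum hmeas).aemeasurable)
  refine lintegral_congr fun ω => ?_
  rw [lintegral_tsum fun n => ((hmeas' ω n).const_mul _).aemeasurable]
  refine tsum_congr fun n => ?_
  rw [lintegral_const_mul _ (hmeas' ω n)]
  congr 1
  have hs : MeasurableSet {t | (z ω, X n ω, t) ∈ R} :=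
    (measurable_const.prodMk (measurable_const.prodMk measurable_id)) hR
  rw [reachLength, ← lintegral_indicator_one hs]
  rfl

lemma cappedMean_le (i m : ℕ) (s : ℝ) : cappedMean P X D i m s ≤ m := by
  calc cappedMean P X D i m s ≤ ∫⁻ _, (m : ℝ≥0∞) ∂P := lintegral_mono fun _ => min_le_right _ _
    _ = m := by simp

/-- Stationarity in the form needed for telescoping. A negative `s` is allowed, both sets then being
null. -/
lemma IsMarkedPoisson.lintegral_min_stubCount (h : IsMarkedPoisson P F X D) (i m : ℕ) {B : Set ℝ}
    (hB : MeasurableSet B) {s : ℝ} (hvol : volume B = ENNReal.ofReal s) :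
    ∫⁻ ω, min (stubCount i B ((fun n => X n ω), (fun n => D n ω))) m ∂P =
      cappedMean P X D i m s :=
  h.lintegral_stubCount_congr i (f := fun c => min c m) (by fun_prop) hB measurableSet_Icc
    (by rw [hvol]; exact ENNReal.ofReal_lt_top) (by rw [hvol, Real.volume_Icc, sub_zero])

/-- Monotone convergence: almost surely infinitely many points of degree at least `i` are positive,
so the capped count is eventually `m`. -/
lemma IsMarkedPoisson.tendsto_cappedMean (h : IsMarkedPoisson P F X D) {i : ℕ}
    (hi : F.toMeasure (Ici i) ≠ 0) (m : ℕ) :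
    Filter.Tendsto (fun k : ℕ => cappedMean P X D i m k) Filter.atTop (nhds m) := by
  have hm : (m : ℝ≥0∞) = ∫⁻ _, (m : ℝ≥0∞) ∂P := by simp
  rw [hm]
  refine lintegral_tendsto_of_tendsto_of_monotone (fun k => ?_) (ae_of_all _ fun ω j k hjk => ?_) ?_
  · exact (((measurable_stubCount i measurableSet_Icc).comp h.measurable_pair).min
      measurable_const).aemeasurable
  · exact min_le_min_right _ (stubCount_mono i
      (Icc_subset_Icc_right (Nat.cast_le.mpr hjk)) _)
  · filter_upwards [h.ae_unbounded hi] with ω hω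
    have hinf : {n | 0 ≤ X n ω ∧ i ≤ D n ω}.Infinite := by
      intro hfin
      obtain ⟨b, hb⟩ := (hfin.image fun n => X n ω).bddAbove
      obtain ⟨n, hn, hni⟩ := (hω (max b 0)).1
      obtain ⟨hn1, hn2⟩ := max_lt_iff.mp hn
      exact (hb ⟨n, ⟨hn2.le, hni⟩, rfl⟩).not_gt hn1
    obtain ⟨s, hs, hcard⟩ := hinf.exists_subset_card_eq m
    obtain ⟨b, hb⟩ := (s.finite_toSet.image fun n => X n ω).bddAbove
    refine tendsto_const_nhds.congr' ?_
    filter_upwards [Filter.eventually_ge_atTop ⌈b⌉₊] with k hk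
    refine (min_eq_right ?_).symm
    rw [stubCount_eq_encard, ← hcard, ← ENat.toENNReal_coe, ← encard_coe_eq_coe_finsetCard]
    refine ENat.toENNReal_mono (encard_le_encard fun n hn => ?_)
    exact ⟨⟨(hs hn).1, (hb ⟨n, hn, rfl⟩).trans (Nat.ceil_le.mp hk)⟩, (hs hn).2⟩

/-- The mean total length of the intervals from the points in `[0, 1)` of degree at least `i` to
the `m`-th such point on their right. -/
lemma IsMarkedPoisson.lintegral_reachRight (h : IsMarkedPoisson P F X D) {i : ℕ}
    (hi : F.toMeasure (Ici i) ≠ 0) (m : ℕ) :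
    ∫⁻ ω, ∑' n, unitWeight i n ((fun n => X n ω), (fun n => D n ω)) *
      reachLength (reachRight i m) ((fun n => X n ω), (fun n => D n ω)) (X n ω) ∂P = m := by
  rw [h.lintegral_tsum_reachLength i (measurableSet_reachRight i m)]
  refine lintegral_eq_of_add_shift_eq (cappedMean_mono i m) (fun s hs => cappedMean_of_neg i m hs)
    (cappedMean_le i m) (h.tendsto_cappedMean hi m) fun t => ?_
  rw [← h.lintegral_min_stubCount i m (measurableSet_Icc (a := (1 : ℝ)) (b := t))
    (by rw [Real.volume_Icc]), cappedMean,
    ← lintegral_add_right _ (h.measurable_min_stubCount i m measurableSet_Icc)]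
  refine lintegral_congr_ae ?_
  filter_upwards [h.ground.injective, h.ground.ae_finite] with ω h1 h2
  exact tsum_reachRight_add i m (z := ((fun n => X n ω), (fun n => D n ω))) h1 (h2 0 t)

/-- The mirror image of `IsMarkedPoisson.lintegral_reachRight`. -/
lemma IsMarkedPoisson.lintegral_reachLeft (h : IsMarkedPoisson P F X D) {i : ℕ}
    (hi : F.toMeasure (Ici i) ≠ 0) (m : ℕ) :
    ∫⁻ ω, ∑' n, unitWeight i n ((fun n => X n ω), (fun n => D n ω)) *
      reachLength (reachLeft i m) ((fun n => X n ω), (fun n => D n ω)) (X n ω) ∂P = m := by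
  -- The substitution `t ↦ 1 - t` gives the intervals `[1 - t, 0)` and `[1 - t, 1)` the lengths `t -
  -- 1` and `t`, so the rightward telescoping applies.
  rw [h.lintegral_tsum_reachLength i (measurableSet_reachLeft i m),
    ← lintegral_sub_left_eq_self _ (1 : ℝ)]
  refine lintegral_eq_of_add_shift_eq (cappedMean_mono i m) (fun s hs => cappedMean_of_neg i m hs)
    (cappedMean_le i m) (h.tendsto_cappedMean hi m) fun t => ?_
  rw [← h.lintegral_min_stubCount i m (measurableSet_Ico (a := 1 - t) (b := (0 : ℝ)))
    (by rw [Real.volume_Ico]; congr 1; ring), ← h.lintegral_min_stubCount i m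
    (measurableSet_Ico (a := 1 - t) (b := (1 : ℝ))) (by rw [Real.volume_Ico]; congr 1; ring),
    ← lintegral_add_right _
    (h.measurable_min_stubCount i m measurableSet_Ico)]
  refine lintegral_congr_ae ?_
  filter_upwards [h.ground.injective, h.ground.ae_finite] with ω h1 h2
  exact tsum_reachLeft_add i m (z := ((fun n => X n ω), (fun n => D n ω))) h1 (h2 (1 - t) 1)

end PoissonPoints

/-! ### Edge lengths in terms of the marked points and the coin -/

/-- The number of points of degree at least `i` between the origin and the `n`-th point is odd. -/
def oddIndex (i n : ℕ) : Set ((ℕ → ℝ) × (ℕ → ℕ)) :=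
  {z | ∃ k : ℕ, stubCount i (Icc 0 (z.1 n)) z = ((2 * k + 1 : ℕ) : ℝ≥0∞)}

/-- The total reach of the points in `[0, 1)` of degree at least `i`, measured by `R` at the points
of odd index and by `R'` at those of even index. -/
def alternatingLength (i : ℕ) (R R' : Set (((ℕ → ℝ) × (ℕ → ℕ)) × ℝ × ℝ))
    (z : (ℕ → ℝ) × (ℕ → ℕ)) : ℝ≥0∞ :=
  ∑' n, unitWeight i n z * ((oddIndex i n).indicator (fun z => reachLength R z (z.1 n)) z +
    (oddIndex i n)ᶜ.indicator (fun z => reachLength R' z (z.1 n)) z)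

lemma measurableSet_oddIndex (i n : ℕ) : MeasurableSet (oddIndex i n) := by
  have h1 : Measurable fun z : (ℕ → ℝ) × (ℕ → ℕ) => z.1 n := by fun_prop
  have h2 := measurable_stubCount_Icc i measurable_id (measurable_const (a := (0 : ℝ))) h1
  have e : oddIndex i n = ⋃ k : ℕ, {z | stubCount i (Icc 0 (z.1 n)) z =
      ((2 * k + 1 : ℕ) : ℝ≥0∞)} := by
    ext z
    simp only [oddIndex, mem_ofPred_eq, mem_iUnion]
  rw [e]
  exact MeasurableSet.iUnion fun k => h2 (measurableSet_singleton _)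

lemma measurable_alternatingLength (i : ℕ) {R R' : Set (((ℕ → ℝ) × (ℕ → ℕ)) × ℝ × ℝ)}
    (hR : MeasurableSet R) (hR' : MeasurableSet R') : Measurable (alternatingLength i R R') :=
  Measurable.tsum fun n => (measurable_unitWeight i n).mul
    (((measurable_reachLength hR n).indicator (measurableSet_oddIndex i n)).add
      ((measurable_reachLength hR' n).indicator (measurableSet_oddIndex i n).compl))

/-- Adding the two outcomes of the coin, every point contributes both reaches and the parity
disappears. -/
lemma alternatingLength_add (i : ℕ) (R R' : Set (((ℕ → ℝ) × (ℕ → ℕ)) × ℝ × ℝ))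
    (z : (ℕ → ℝ) × (ℕ → ℕ)) :
    alternatingLength i R R' z + alternatingLength i R' R z =
      ∑' n, unitWeight i n z * reachLength R z (z.1 n) +
        ∑' n, unitWeight i n z * reachLength R' z (z.1 n) := by
  rw [alternatingLength, alternatingLength, ← ENNReal.tsum_add, ← ENNReal.tsum_add]
  refine tsum_congr fun n => ?_
  by_cases h : z ∈ oddIndex i n
  · simp [h]
  · simp [h, add_comm]

section Pathwise

variable {Ω : Type*} {X : ℕ → Ω → ℝ} {D : ℕ → Ω → ℕ} {M : ℕ → Ω → SimpleGraph ℝ} {ω : Ω} {i : ℕ}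

lemma mem_level_markedSet {x : ℝ} : x ∈ level (markedSet X D ω) i ↔
    ∃ n, X n ω = x ∧ i ≤ D n ω := by
  simp only [level, markedSet, mem_ofPred_eq, mem_range, Prod.mk.injEq]
  constructor
  · rintro ⟨d, ⟨n, h1, h2⟩, h3⟩
    exact ⟨n, h1, h2 ▸ h3⟩
  · rintro ⟨n, h1, h2⟩
    exact ⟨D n ω, ⟨n, h1, rfl⟩, h2⟩

lemma apply_mem_level_iff (hX : Function.Injective fun n => X n ω) (n : ℕ) :
    X n ω ∈ level (markedSet X D ω) i ↔ i ≤ D n ω := by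
  rw [mem_level_markedSet]
  constructor
  · rintro ⟨m, h1, h2⟩
    rwa [← hX h1]
  · exact fun h => ⟨n, rfl, h⟩

lemma isBiinfinite_level (hfin : ∀ a b, {n | X n ω ∈ Icc a b}.Finite)
    (hub : ∀ a : ℝ, (∃ n, a < X n ω ∧ i ≤ D n ω) ∧ ∃ n, X n ω < a ∧ i ≤ D n ω) :
    IsBiinfinite (level (markedSet X D ω) i) where
  finite a b := by
    refine ((hfin a b).image fun n => X n ω).subset ?_
    rintro x ⟨hx, hab⟩
    obtain ⟨n, rfl, -⟩ := mem_level_markedSet.mp hx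
    exact ⟨n, hab, rfl⟩
  above a := by
    obtain ⟨n, h1, h2⟩ := (hub a).1
    exact ⟨X n ω, mem_level_markedSet.mpr ⟨n, rfl, h2⟩, h1⟩
  below a := by
    obtain ⟨n, h1, h2⟩ := (hub a).2
    exact ⟨X n ω, mem_level_markedSet.mpr ⟨n, rfl, h2⟩, h1⟩

lemma stubCount_eq_ncard (hX : Function.Injective fun n => X n ω) {B : Set ℝ}
    (hfin : (level (markedSet X D ω) i ∩ B).Finite) :
    stubCount i B ((fun n => X n ω), (fun n => D n ω)) =
      ((level (markedSet X D ω) i ∩ B).ncard : ℝ≥0∞) := by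
  have : level (markedSet X D ω) i ∩ B =
      (fun n => X n ω) '' {n | X n ω ∈ B ∧ i ≤ D n ω} := by
    ext x
    rw [mem_inter_iff, mem_level_markedSet]
    constructor
    · rintro ⟨⟨n, rfl, h1⟩, h2⟩
      exact ⟨n, ⟨h2, h1⟩, rfl⟩
    · rintro ⟨n, ⟨h2, h1⟩, rfl⟩
      exact ⟨⟨n, rfl, h1⟩, h2⟩
  rw [← ENat.toENNReal_coe, hfin.cast_ncard_eq, this, hX.injOn.encard_image, stubCount_eq_encard]

lemma tsum_sam_pts (hX : Function.Injective fun n => X n ω) (f : Config → ℝ≥0∞) :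
    ∑' x : ↥((sam X D M ω).pts ∩ Ico 0 1), f ((sam X D M ω).shift x) =
      ∑' n, (Ico (0 : ℝ) 1).indicator (fun x => f ((sam X D M ω).shift x)) (X n ω) := by
  have hpts : (sam X D M ω).pts = range fun n => X n ω := by
    ext x
    simp only [Config.pts, sam, samConfig, markedSet, mem_ofPred_eq, mem_range, Prod.mk.injEq]
    constructor
    · rintro ⟨d, n, h1, h2⟩
      exact ⟨n, h1⟩
    · rintro ⟨n, h1⟩
      exact ⟨D n ω, n, h1, rfl⟩
  rw [hpts, tsum_subtype (range (fun n => X n ω) ∩ Ico 0 1)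
    (fun x => f ((sam X D M ω).shift x)), ← indicator_indicator,
    ← hX.tsum_eq (f := (range fun n => X n ω).indicator _) support_indicator_subset]
  refine tsum_congr fun n => ?_
  rw [indicator_of_mem (mem_range_self n)]

lemma sam_shift_mem_originDegGe {x : ℝ} :
    (sam X D M ω).shift x ∈ originDegGe i ↔ x ∈ level (markedSet X D ω) i := by
  simp [originDegGe, level, Config.shift, sam, samConfig]

lemma tsum_edgeLength_eq_zero
    (hM : i = 0 ∨ IsAdjacentMatching (level (markedSet X D ω) i) (M i ω))
    (h : i = 0 ∨ ∀ n, D n ω < i) :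
    ∑' x : ↥((sam X D M ω).pts ∩ Ico 0 1), edgeLength i ((sam X D M ω).shift x) = 0 := by
  refine ENNReal.tsum_eq_zero.mpr fun x => edgeLength_shift_eq_zero hM ?_
  refine h.imp id fun h hx => ?_
  obtain ⟨n, -, hn⟩ := mem_level_markedSet.mp hx
  exact (h n).not_ge hn

/-- If the coin is `true`, a pair surrounds the origin and the positive points of odd index are
left-oriented; otherwise the roles of the parities are exchanged. -/
lemma tsum_edgeLength_eq (hX : Function.Injective fun n => X n ω)
    (hS : IsBiinfinite (level (markedSet X D ω) i)) (h0 : ∀ n, X n ω ≠ 0) (hi : 1 ≤ i)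
    (hM : IsAdjacentMatching (level (markedSet X D ω) i) (M i ω)) {c : Bool}
    (hc : c = true ↔ ∃ x y, (M i ω).Adj x y ∧ x < 0 ∧ 0 < y) :
    ∑' x : ↥((sam X D M ω).pts ∩ Ico 0 1), edgeLength i ((sam X D M ω).shift x) =
      if c = true then alternatingLength i (reachLeft i (2 * i - 1)) (reachRight i (2 * i - 1))
        ((fun n => X n ω), (fun n => D n ω))
      else alternatingLength i (reachRight i (2 * i - 1)) (reachLeft i (2 * i - 1))
        ((fun n => X n ω), (fun n => D n ω)) := by
  set S := level (markedSet X D ω) i with hSdef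
  have h0S : (0 : ℝ) ∉ S := fun h => by
    obtain ⟨n, hn, -⟩ := mem_level_markedSet.mp h
    exact h0 n hn
  have hcount : ∀ a b, stubCount i (Icc a b) ((fun n => X n ω), (fun n => D n ω)) =
      ((S ∩ Icc a b).ncard : ℝ≥0∞) := fun a b => stubCount_eq_ncard hX (hS.finite a b)
  have hright : ∀ x, RightOriented (M i ω) x → edgeLength i ((sam X D M ω).shift x) =
      reachLength (reachRight i (2 * i - 1)) ((fun n => X n ω), (fun n => D n ω)) x := by
    intro x hx
    refine (edgeLength_shift_of_right hM hS hi hx).trans ?_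
    simp only [reachLength, reachRight, mem_ofPred_eq, hcount, Nat.cast_le]
    rfl
  have hleft : ∀ x, LeftOriented (M i ω) x → edgeLength i ((sam X D M ω).shift x) =
      reachLength (reachLeft i (2 * i - 1)) ((fun n => X n ω), (fun n => D n ω)) x := by
    intro x hx
    refine (edgeLength_shift_of_left hM hS hi hx).trans ?_
    simp only [reachLength, reachLeft, mem_ofPred_eq, hcount, Nat.cast_le]
    rfl
  have hodd : ∀ n, ((fun n => X n ω), (fun n => D n ω)) ∈ oddIndex i n ↔
      Odd (S ∩ Ioc 0 (X n ω)).ncard := by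
    intro n
    have : S ∩ Ioc 0 (X n ω) = S ∩ Icc 0 (X n ω) := by
      ext x
      exact ⟨fun h => ⟨h.1, h.2.1.le, h.2.2⟩,
        fun h => ⟨h.1, lt_of_le_of_ne h.2.1 fun e => h0S (e ▸ h.1), h.2.2⟩⟩
    rw [this]
    simp only [oddIndex, mem_ofPred_eq, hcount, Nat.cast_inj]
    rfl
  rw [tsum_sam_pts hX]
  -- The condition on the degree may be inserted because the edge length vanishes where it fails.
  have hterm : ∀ n, (Ico (0 : ℝ) 1).indicator
      (fun x => edgeLength i ((sam X D M ω).shift x)) (X n ω) =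
      unitWeight i n ((fun n => X n ω), (fun n => D n ω)) *
        edgeLength i ((sam X D M ω).shift (X n ω)) := by
    intro n
    by_cases h1 : X n ω ∈ Ico (0 : ℝ) 1
    · by_cases h2 : i ≤ D n ω
      · simp [unitWeight, indicator, h1, h2, -mem_Ico]
      · have hz : edgeLength i ((sam X D M ω).shift (X n ω)) = 0 :=
          edgeLength_shift_eq_zero (Or.inr hM) (Or.inr (mt (apply_mem_level_iff hX n).mp h2))
        simp [indicator, hz]
    · simp [unitWeight, indicator, h1, -mem_Ico]
  simp_rw [hterm]
  have hmul : ∀ n (a : ℝ≥0∞), (X n ω ∈ S → 0 < X n ω →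
      edgeLength i ((sam X D M ω).shift (X n ω)) = a) →
      unitWeight i n ((fun n => X n ω), (fun n => D n ω)) *
        edgeLength i ((sam X D M ω).shift (X n ω)) =
      unitWeight i n ((fun n => X n ω), (fun n => D n ω)) * a := by
    intro n a ha
    by_cases h1 : X n ω ∈ Ico (0 : ℝ) 1
    · by_cases h2 : i ≤ D n ω
      · rw [ha ((apply_mem_level_iff hX n).mpr h2) (lt_of_le_of_ne h1.1 (h0 n).symm)]
      · simp [unitWeight, h2]
    · simp [unitWeight, h1, -mem_Ico]
  split_ifs with hct
  all_goals
    refine tsum_congr fun n => hmul n _ fun hn hn0 => ?_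
    have hor := hM.left_iff_odd hS h0S hn hn0
    rw [← hodd n, ← hc] at hor
    by_cases ho : ((fun n => X n ω), (fun n => D n ω)) ∈ oddIndex i n
    · simp only [ho, hct, true_iff, iff_true] at hor
      simp only [indicator_of_mem ho, indicator_of_notMem (notMem_compl_iff.mpr ho), add_zero]
      first
        | exact hleft _ hor
        | exact hright _ ((hM.not_left_iff hn).mp (by simp [hor]))
    · simp only [ho, hct, false_iff, iff_false, not_true_eq_false] at hor
      simp only [indicator_of_notMem ho, indicator_of_mem (mem_compl ho), zero_add]
      first
        | exact hleft _ (by simpa using hor)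
        | exact hright _ ((hM.not_left_iff hn).mp (by simp [hor]))

end Pathwise

/-! ### Palm expectations of the edge lengths -/

section Palm

variable {Ω : Type*} [MeasurableSpace Ω] {P : Measure Ω}
  {X : ℕ → Ω → ℝ} {D : ℕ → Ω → ℕ} {F : PMF ℕ} {M : ℕ → Ω → SimpleGraph ℝ}

lemma IsUniformAdjacentChoice.lintegral_edgeLength_of_eq_zero (h : IsMarkedPoisson P F X D)
    (hM : IsUniformAdjacentChoice P X D M) {i : ℕ} (hi : i = 0 ∨ F.toMeasure (Ici i) = 0) :
    (fun ω => ∑' x : ↥((sam X D M ω).pts ∩ Ico 0 1),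
      edgeLength i ((sam X D M ω).shift x)) =ᵐ[P] 0 := by
  rcases Nat.eq_zero_or_pos i with rfl | hi'
  · exact ae_of_all _ fun ω => tsum_edgeLength_eq_zero (Or.inl rfl) (Or.inl rfl)
  · filter_upwards [hM.1, h.ae_mark_lt (hi.resolve_left hi'.ne')] with ω h1 h2
    exact tsum_edgeLength_eq_zero (Or.inr (h1 i hi')) (Or.inr h2)

variable [IsProbabilityMeasure P]

/-- The normalising constant is the intensity, the mean number of points in `[0, 1)`, which is `1`.
-/
lemma IsMarkedPoisson.palmExp_eq (h : IsMarkedPoisson P F X D) (f : Config → ℝ≥0∞) :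
    palmExp P (sam X D M) f = ∫⁻ ω, ∑' x : ↥((sam X D M ω).pts ∩ Ico 0 1),
      f ((sam X D M ω).shift x) ∂P := by
  have hden : ∫⁻ ω, (((sam X D M ω).pts ∩ Ico 0 1).encard : ℝ≥0∞) ∂P = 1 := by
    have h1 := h.ground.lintegral_pointCount (measurableSet_Ico (a := (0 : ℝ)) (b := 1)) (by simp)
    rw [Real.volume_Ico, sub_zero, ENNReal.ofReal_one] at h1
    rw [← h1]
    refine lintegral_congr_ae ?_
    filter_upwards [h.ground.injective] with ω hω
    rw [← ENNReal.tsum_set_one]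
    exact tsum_sam_pts hω (fun _ => 1)
  rw [palmExp, hden, div_one]

lemma IsMarkedPoisson.palmExp_originDegGe (h : IsMarkedPoisson P F X D) (i : ℕ) :
    palmExp P (sam X D M) ((originDegGe i).indicator 1) = F.toMeasure (Ici i) := by
  have h1 := h.lintegral_stubCount i (measurableSet_Ico (a := (0 : ℝ)) (b := 1)) (by simp)
  rw [Real.volume_Ico, sub_zero, ENNReal.ofReal_one, mul_one] at h1
  rw [h.palmExp_eq, ← h1]
  refine lintegral_congr_ae ?_
  filter_upwards [h.ground.injective] with ω hω
  rw [tsum_sam_pts hω]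
  refine tsum_congr fun n => ?_
  by_cases h1 : X n ω ∈ Ico (0 : ℝ) 1
  · by_cases h2 : i ≤ D n ω
    · have := sam_shift_mem_originDegGe (M := M).mpr ((apply_mem_level_iff hω n).mpr h2)
      simp [indicator, h1, h2, this, -mem_Ico]
    · have := mt (sam_shift_mem_originDegGe (M := M).mp) (mt (apply_mem_level_iff hω n).mp h2)
      simp [indicator, h2, this, -mem_Ico]
  · simp [indicator, h1, -mem_Ico]

lemma IsUniformAdjacentChoice.palmExp_indicator_edgeLength (h : IsMarkedPoisson P F X D)
    (hM : IsUniformAdjacentChoice P X D M) {i : ℕ} (hi : 1 ≤ i) :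
    palmExp P (sam X D M) ((originDegGe i).indicator (edgeLength i)) =
      palmExp P (sam X D M) (edgeLength i) := by
  rw [h.palmExp_eq, h.palmExp_eq]
  refine lintegral_congr_ae ?_
  filter_upwards [hM.1] with ω hω
  refine tsum_congr fun x => ?_
  by_cases hx : (sam X D M ω).shift x ∈ originDegGe i
  · rw [indicator_of_mem hx]
  · rw [indicator_of_notMem hx]
    exact (edgeLength_shift_eq_zero (Or.inr (hω i hi))
      (Or.inr (mt sam_shift_mem_originDegGe.mpr hx))).symm

/-- The edge lengths over the unit interval: measurability and mean. -/
lemma IsUniformAdjacentChoice.lintegral_edgeLength (h : IsMarkedPoisson P F X D)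
    (hM : IsUniformAdjacentChoice P X D M) {i : ℕ} (hi : 1 ≤ i) (hF : F.toMeasure (Ici i) ≠ 0) :
    AEMeasurable (fun ω => ∑' x : ↥((sam X D M ω).pts ∩ Ico 0 1),
      edgeLength i ((sam X D M ω).shift x)) P ∧
    ∫⁻ ω, ∑' x : ↥((sam X D M ω).pts ∩ Ico 0 1), edgeLength i ((sam X D M ω).shift x) ∂P =
      ((2 * i - 1 : ℕ) : ℝ≥0∞) := by
  obtain ⟨hadj, coin, hcm, hchalf, -, hind, hcoin⟩ := hM
  set m := 2 * i - 1
  set z : Ω → (ℕ → ℝ) × (ℕ → ℕ) := fun ω => ((fun n => X n ω), (fun n => D n ω)) with hz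
  have hzm : Measurable z := h.measurable_pair
  set G : Bool → (ℕ → ℝ) × (ℕ → ℕ) → ℝ≥0∞ := fun b =>
    if b = true then alternatingLength i (reachLeft i m) (reachRight i m)
    else alternatingLength i (reachRight i m) (reachLeft i m) with hG
  have hR := measurableSet_reachRight i m
  have hL := measurableSet_reachLeft i m
  have hGm : ∀ b, Measurable (G b) := by
    rintro (_ | _)
    · exact measurable_alternatingLength i hR hL
    · exact measurable_alternatingLength i hL hR
  have hGz : ∀ b, Measurable fun ω => G b (z ω) := fun b => (hGm b).comp hzm
  set J : Bool → Ω → ℝ≥0∞ := fun b ω => ({b} : Set Bool).indicator 1 (coin i ω) with hJ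
  have hJm : ∀ b, Measurable (J b) := fun b =>
    (measurable_one.indicator (measurableSet_singleton b)).comp (hcm i)
  have hGJ : ∀ b, Measurable fun ω => G b (z ω) * J b ω := fun b => (hGz b).mul (hJm b)
  have hae : (fun ω => ∑' x : ↥((sam X D M ω).pts ∩ Ico 0 1),
      edgeLength i ((sam X D M ω).shift x)) =ᵐ[P]
      fun ω => G true (z ω) * J true ω + G false (z ω) * J false ω := by
    filter_upwards [hadj, hcoin, h.ground.injective, h.ground.ae_finite, h.ground.ae_ne_zero,
      h.ae_unbounded hF] with ω h1 h2 h3 h4 h5 h6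
    have hS := isBiinfinite_level h4 h6
    obtain ⟨x, hx, -⟩ := hS.above 0
    rw [tsum_edgeLength_eq h3 hS h5 hi (h1 i hi) (h2 i hi ⟨x, hx⟩)]
    cases hc : coin i ω <;> simp [hG, hJ, hz, hc, m]
  -- The coin is independent of the marked points, so each of its values contributes with weight one
  -- half.
  have hind' : ∀ b, ∫⁻ ω, G b (z ω) * J b ω ∂P = (∫⁻ ω, G b (z ω) ∂P) * 2⁻¹ := by
    intro b
    have h1 : IndepFun (fun ω => G b (z ω)) (J b) P :=
      hind.comp (φ := G b) (ψ := fun s : ℕ → Bool => ({b} : Set Bool).indicator 1 (s i))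
        (hGm b) ((measurable_one.indicator (measurableSet_singleton b)).comp
          (measurable_pi_apply i))
    have h2 := lintegral_mul_eq_lintegral_mul_lintegral_of_indepFun ((hGm b).comp hzm) (hJm b) h1
    refine h2.trans ?_
    congr 1
    have hset : ∀ b, MeasurableSet {ω | coin i ω = b} := fun b =>
      hcm i (measurableSet_singleton b)
    have h3 : ∫⁻ ω, J b ω ∂P = P {ω | coin i ω = b} := by
      rw [← lintegral_indicator_one (hset b)]
      rfl
    rw [h3]
    cases b
    · have h4 : {ω | coin i ω = false} = {ω | coin i ω = true}ᶜ := by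
        ext ω
        simp
      rw [h4, prob_compl_eq_one_sub (hset true), hchalf i, one_div, ENNReal.one_sub_inv_two]
    · rw [hchalf i, one_div]
  refine ⟨AEMeasurable.congr ?_ hae.symm, ?_⟩
  · exact ((hGJ true).add (hGJ false)).aemeasurable
  rw [lintegral_congr_ae hae, lintegral_add_left (hGJ true), hind', hind', ← add_mul,
    ← lintegral_add_left (hGz true)]
  have hsum : ∀ ω, G true (z ω) + G false (z ω) =
      ∑' n, unitWeight i n (z ω) * reachLength (reachLeft i m) (z ω) (X n ω) +
        ∑' n, unitWeight i n (z ω) * reachLength (reachRight i m) (z ω) (X n ω) := fun ω =>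
    alternatingLength_add i (reachLeft i m) (reachRight i m) (z ω)
  have hmeas : Measurable fun ω => ∑' n, unitWeight i n (z ω) *
      reachLength (reachLeft i m) (z ω) (X n ω) :=
    Measurable.tsum fun n =>
      ((measurable_unitWeight i n).comp hzm).mul ((measurable_reachLength hL n).comp hzm)
  rw [lintegral_congr hsum, lintegral_add_left hmeas, h.lintegral_reachLeft hF,
    h.lintegral_reachRight hF, ← two_mul, mul_comm, ← mul_assoc,
    ENNReal.inv_mul_cancel two_ne_zero ENNReal.ofNat_ne_top, one_mul]

open Classical in
-- Sum over levels and expectation are exchanged, which is why measurability accompanies the mean in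
-- `IsUniformAdjacentChoice.lintegral_edgeLength`.
lemma IsUniformAdjacentChoice.palmExp_totalLength (h : IsMarkedPoisson P F X D)
    (hM : IsUniformAdjacentChoice P X D M) :
    palmExp P (sam X D M) totalLength =
      ∑' i : ℕ, if i = 0 ∨ F.toMeasure (Ici i) = 0 then 0 else ((2 * i - 1 : ℕ) : ℝ≥0∞) := by
  rw [h.palmExp_eq]
  simp only [totalLength]
  simp_rw [ENNReal.tsum_comm (β := ℕ)]
  rw [lintegral_tsum]
  · refine tsum_congr fun i => ?_
    split_ifs with hi
    · rw [lintegral_congr_ae (hM.lintegral_edgeLength_of_eq_zero h hi)]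
      simp
    · obtain ⟨hi1, hi2⟩ := not_or.mp hi
      exact (hM.lintegral_edgeLength h (Nat.pos_of_ne_zero hi1) hi2).2
  · intro i
    by_cases hi : i = 0 ∨ F.toMeasure (Ici i) = 0
    · exact aemeasurable_zero.congr (hM.lintegral_edgeLength_of_eq_zero h hi).symm
    · obtain ⟨hi1, hi2⟩ := not_or.mp hi
      exact (hM.lintegral_edgeLength h (Nat.pos_of_ne_zero hi1) hi2).1

end Palm

/-! ### The support of `F` and the sum over levels -/

lemma toMeasure_Ici_eq_zero_iff (F : PMF ℕ) (i : ℕ) :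
    F.toMeasure (Ici i) = 0 ↔ ∀ j ∈ F.support, j < i := by
  rw [PMF.toMeasure_apply_eq_zero_iff _ measurableSet_Ici, disjoint_left]
  simp only [mem_Ici, not_le]

lemma sum_range_odd (u : ℕ) :
    ∑ i ∈ Finset.range (u + 1), (if i = 0 then 0 else 2 * i - 1) = u ^ 2 := by
  induction u with
  | zero => simp
  | succ u ih =>
    rw [Finset.sum_range_succ, ih, if_neg (Nat.succ_ne_zero u)]
    have : 2 * (u + 1) - 1 = 2 * u + 1 := by omega
    rw [this]
    ring

open Classical in
lemma tsum_of_isGreatest {F : PMF ℕ} {u : ℕ} (hu : IsGreatest F.support u) :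
    ∑' i : ℕ, (if i = 0 ∨ F.toMeasure (Ici i) = 0 then 0 else ((2 * i - 1 : ℕ) : ℝ≥0∞)) =
      (u : ℝ≥0∞) ^ 2 := by
  have hiff : ∀ i, F.toMeasure (Ici i) = 0 ↔ u < i := fun i => by
    rw [toMeasure_Ici_eq_zero_iff]
    exact ⟨fun h => h u hu.1, fun h j hj => (hu.2 hj).trans_lt h⟩
  simp only [hiff]
  rw [tsum_eq_sum (s := Finset.range (u + 1))]
  · rw [← Nat.cast_pow, ← sum_range_odd, Nat.cast_sum]
    refine Finset.sum_congr rfl fun i hi => ?_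
    have : ¬ u < i := by
      have := Finset.mem_range.mp hi
      omega
    by_cases h0 : i = 0 <;> simp [h0, this]
  · intro i hi
    rw [if_pos]
    right
    by_contra h
    exact hi (Finset.mem_range.mpr (by omega))

open Classical in
-- Every level is charged by `F`, so all terms with `i ≥ 1` are at least `1`.
lemma tsum_of_not_bddAbove {F : PMF ℕ} (hF : ¬ BddAbove F.support) :
    ∑' i : ℕ, (if i = 0 ∨ F.toMeasure (Ici i) = 0 then 0 else ((2 * i - 1 : ℕ) : ℝ≥0∞)) = ∞ := by
  have hne : ∀ i, F.toMeasure (Ici i) ≠ 0 := fun i h => by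
    rw [toMeasure_Ici_eq_zero_iff] at h
    exact hF ⟨i, fun j hj => (h j hj).le⟩
  rw [tsum_eq_zero_add' ENNReal.summable, eq_top_iff,
    ← ENNReal.tsum_const_eq_top_of_ne_zero (α := ℕ) (c := 1) one_ne_zero]
  refine le_add_left (ENNReal.tsum_le_tsum fun i => ?_)
  rw [if_neg (by simp [hne])]
  exact_mod_cast (by omega : 1 ≤ 2 * (i + 1) - 1)

end SAM

end

theorem proposition2 {Ω : Type*} [MeasurableSpace Ω] (P : Measure Ω) [IsProbabilityMeasure P]
    (F : PMF ℕ) (X : ℕ → Ω → ℝ) (D : ℕ → Ω → ℕ) (M : ℕ → Ω → SimpleGraph ℝ)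
    (hXD : SAM.IsMarkedPoisson P F X D) (hM : SAM.IsUniformAdjacentChoice P X D M) :
    (∀ u : ℕ, IsGreatest F.support u →
      SAM.palmExp P (SAM.sam X D M) SAM.totalLength = (u : ℝ≥0∞) ^ 2) ∧
    (∀ i : ℕ, 1 ≤ i → F.toMeasure (Ici i) ≠ 0 →
      SAM.palmCondExp P (SAM.sam X D M) (SAM.edgeLength i) (SAM.originDegGe i) =
        ((2 * i - 1 : ℕ) : ℝ≥0∞) / F.toMeasure (Ici i)) ∧
    (SAM.palmExp P (SAM.sam X D M) SAM.totalLength < ∞ ↔ BddAbove F.support) := by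
  have hgreatest : ∀ u : ℕ, IsGreatest F.support u →
      SAM.palmExp P (SAM.sam X D M) SAM.totalLength = (u : ℝ≥0∞) ^ 2 := fun u hu => by
    rw [hM.palmExp_totalLength hXD, SAM.tsum_of_isGreatest hu]
  refine ⟨hgreatest, fun i hi hF => ?_, fun hlt => ?_, fun hb => ?_⟩
  · rw [SAM.palmCondExp, hM.palmExp_indicator_edgeLength hXD hi, hXD.palmExp_originDegGe,
      hXD.palmExp_eq, (hM.lintegral_edgeLength hXD hi hF).2]
  · by_contra hb
    rw [hM.palmExp_totalLength hXD, SAM.tsum_of_not_bddAbove hb] at hlt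
    exact lt_irrefl _ hlt
  -- A bounded support, being nonempty, contains its supremum, so the first claim gives a finite
  -- value.
  · rw [hgreatest _ ⟨Nat.sSup_mem F.support_nonempty hb, fun j hj => le_csSup hb hj⟩]
    exact ENNReal.pow_lt_top (ENNReal.natCast_lt_top _)
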